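/- All graphs are nonempty finite loopless multigraphs. A cover of a graph $G$ is a triple $\mathcal H=(L,H,M)$, where $L$ assigns to each vertex of $G$ a nonempty finite set, the sets $L(v)$ being pairwise disjoint; $H$ is a multigraph with vertex set $\bigcup_{v\in V(G)}L(v)$; each $H[L(v)]$ is a complete simple graph; and $M$ assigns to each edge $e$ of $G$ with endpoints $x,y$ a matching $M(e)$ of $H$, each edge of which has one endpoint in $L(x)$ and one in $L(y)$, such that $M(e)\cap M(f)=\emptyset$ for distinct edges $e,f$ of $G$ and, for distinct vertices $x,y$ of $G$, the set of edges of $H$ between $L(x)$ and $L(y)$ is the union of the sets $M(e)$ over the edges $e$ of $G$ with endpoints $x,y$. The cover is a full $m$-fold cover if $|L(v)|=m$ for every $v\in V(G)$ and, for all distinct $x,y\in V(G)$, the number of edges of $H$ between $L(x)$ and $L(y)$ is $m$ times the number of edges of $G$ with endpoints $x,y$. Let $P_{DP}(G,\mathcal H)$ be the number of independent sets of $H$ of size $|V(G)|$. The DP color function $P_{DP}(G,m)$ and the dual DP color function $P^*_{DP}(G,m)$ are the minimum and the maximum, respectively, of $P_{DP}(G,\mathcal H)$ over all full $m$-fold covers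 $\mathcal H$ of $G$. For an edge $e$ of $G$, $G-e$ is obtained by deleting $e$, and $G\cdot e$ is obtained by deleting $e$, identifying its endpoints, and deleting any loops formed (parallel edges are kept). **Proposition.** Let $k,l\ge 1$ be integers, let $G_1=C_{2k+1}$ and $G_2=C_{2l+1}$ be cycles with $|V(G_1)\cap V(G_2)|=2$ and $E(G_1)\cap E(G_2)=\{uv\}$, and let $G$ be the graph with vertex set $V(G_1)\cup V(G_2)$ and edge set $E(G_1)\cup E(G_2)$. Then for every integer $m\ge 2$, $$P^*_{DP}(G,m)=(m-1)^{2k+2l}+(m-1)-\frac{\left((m-1)^{2k}-1\right)\left((m-1)^{2l}-1\right)}{m},$$ and $$P^*_{DP}(G,m)=P^*_{DP}(G-uv,m)-P_{DP}(G\cdot uv,m).$$ -/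

import Mathlib

open scoped Graph

namespace DPColoring

/-- `G` is a cycle `C_n` (for `n ≥ 2`): its vertices `x i` and its edges `f i` can be listed without repetition
in cyclic order, the edge `f i` joining `x i` to `x (i + 1)`, with indices modulo `n`. -/
def IsCycle {α β : Type*} (G : Graph α β) (n : ℕ) : Prop :=
  ∃ (x : ZMod n → α) (f : ZMod n → β), Function.Injective x ∧ Function.Injective f ∧
    V(G) = Set.range x ∧ E(G) = Set.range f ∧ ∀ i, G.IsLink (f i) (x i) (x (i + 1))

/-- `G · e`, for an edge `e` with endpoints `u` and `v` of a loopless multigraph `G`: the edge `e`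
is deleted, `u` and `v` are identified (the new vertex is called `u`), and the loops that this
creates are deleted. Edges that become parallel are kept. -/
noncomputable def contractEdge {α β : Type*} (G : Graph α β) (e : β) (u v : α) : Graph α β :=
  open Classical in
  let K : Graph α β := (G.deleteEdges {e}).map (fun x => if x = v then u else x)
  K.deleteEdges {f | ∃ x, K.IsLoopAt f x}

/-- The edges of `H` that have one endpoint in `S` and one endpoint in `T`. -/
def edgesBetween {C D : Type*} (H : Graph C D) (S T : Set C) : Set D :=
  {d | ∃ a ∈ S, ∃ b ∈ T, H.IsLink d a b}

/-- A cover `(L, H, M)` of the multigraph `G`, where `H` has vertices in `C` and edges in `D`.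
Only the values of `L` on `V(G)` and of `M` on `E(G)` matter. -/
structure Cover {α β : Type*} (G : Graph α β) (C D : Type*) where
  /-- the lists -/
  L : α → Set C
  /-- the cover graph -/
  H : Graph C D
  /-- the matchings -/
  M : β → Set D
  finite_L : ∀ v ∈ V(G), (L v).Finite
  nonempty_L : ∀ v ∈ V(G), (L v).Nonempty
  vertexSet_H : V(H) = ⋃ v ∈ V(G), L v
  /-- each edge of `M e` goes between the lists of the two endpoints of `e` -/
  M_subset : ∀ e u v, G.IsLink e u v → M e ⊆ edgesBetween H (L u) (L v)
  /-- `M e` is a matching: distinct edges of `M e` have no common endpoint -/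
  M_matching : ∀ e ∈ E(G), ∀ d ∈ M e, ∀ d' ∈ M e, ∀ a, H.Inc d a → H.Inc d' a → d = d'
  disjoint_L : ∀ u ∈ V(G), ∀ v ∈ V(G), u ≠ v → Disjoint (L u) (L v)
  /-- `H[L(u)]` is a complete simple graph: no loops, exactly one edge between distinct vertices -/
  loopless_L : ∀ u ∈ V(G), ∀ a ∈ L u, ∀ d, ¬ H.IsLink d a a
  complete_L : ∀ u ∈ V(G), ∀ a ∈ L u, ∀ b ∈ L u, a ≠ b → ∃! d, H.IsLink d a b
  disjoint_M : ∀ e ∈ E(G), ∀ f ∈ E(G), e ≠ f → Disjoint (M e) (M f)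
  edgesBetween_L : ∀ u ∈ V(G), ∀ v ∈ V(G), u ≠ v →
    edgesBetween H (L u) (L v) = ⋃ e ∈ {e | G.IsLink e u v}, M e

namespace Cover

variable {α β C D : Type*} {G : Graph α β}

/-- The cover is a full `m`-fold cover: every list has `m` elements, and there are
`e_G(u,v) * m` edges between `L(u)` and `L(v)` for distinct `u`, `v`. -/
def IsFull (𝓗 : Cover G C D) (m : ℕ) : Prop :=
  (∀ u ∈ V(G), (𝓗.L u).ncard = m) ∧
  ∀ u ∈ V(G), ∀ v ∈ V(G), u ≠ v →
    (edgesBetween 𝓗.H (𝓗.L u) (𝓗.L v)).ncard = {e | G.IsLink e u v}.ncard * m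

/-- The `𝓗`-colorings of `G`: the independent sets of `H` of size `|V(G)|`. -/
def colorings (𝓗 : Cover G C D) : Set (Set C) :=
  {I | I ⊆ V(𝓗.H) ∧ (∀ a ∈ I, ∀ b ∈ I, ¬ 𝓗.H.Adj a b) ∧ I.ncard = V(G).ncard}

/-- `P_DP(G, 𝓗)`, the number of `𝓗`-colorings of `G`. -/
noncomputable def numColorings (𝓗 : Cover G C D) : ℕ := 𝓗.colorings.ncard

end Cover

/-- The set of all numbers `P_DP(G, 𝓗)`, over all full `m`-fold covers `𝓗` of `G`. (Cover graphs of
finite graphs are finite, so up to isomorphism they all have vertices and edges in types of the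
lowest universe.) -/
def fullCounts {α β : Type*} (G : Graph α β) (m : ℕ) : Set ℕ :=
  {n | ∃ (C D : Type) (𝓗 : Cover G C D), 𝓗.IsFull m ∧ 𝓗.numColorings = n}

/-- The DP color function `P_DP(G, m)` of a finite loopless multigraph: the minimum of
`P_DP(G, 𝓗)` over full `m`-fold covers. -/
noncomputable def dpColor {α β : Type*} (G : Graph α β) (m : ℕ) : ℕ := sInf (fullCounts G m)

/-- The dual DP color function `P*_DP(G, m)` of a finite loopless multigraph: the maximum of
`P_DP(G, 𝓗)` over full `m`-fold covers. -/
noncomputable def dualDPColor {α β : Type*} (G : Graph α β) (m : ℕ) : ℕ := sSup (fullCounts G m)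

/-! The infimum and the supremum above are a true minimum and a true maximum. -/

theorem fullCounts_nonempty {α β : Type*} (G : Graph α β) [G.Loopless] (hV : V(G).Finite)
    (hE : E(G).Finite) (m : ℕ) (hm : 1 ≤ m) : (fullCounts G m).Nonempty := by
  obtain ⟨φ, hφ⟩ := Set.countable_iff_exists_injOn.1 hV.countable
  obtain ⟨ψ, hψ⟩ := Set.countable_iff_exists_injOn.1 hE.countable
  let lnk : (ℕ × Fin m × Fin m) ⊕ (ℕ × Fin m) → ℕ × Fin m → ℕ × Fin m → Prop := fun d p q =>
    (∃ n i j, d = Sum.inl (n, i, j) ∧ i < j ∧ n ∈ φ '' V(G) ∧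
      ((p = (n, i) ∧ q = (n, j)) ∨ (p = (n, j) ∧ q = (n, i)))) ∨
    (∃ e u v j, d = Sum.inr (ψ e, j) ∧ G.IsLink e u v ∧ p = (φ u, j) ∧ q = (φ v, j))
  let H : Graph (ℕ × Fin m) ((ℕ × Fin m × Fin m) ⊕ (ℕ × Fin m)) :=
    { vertexSet := {p | p.1 ∈ φ '' V(G)}
      IsLink := lnk
      isLink_symm := by
        intro d _
        refine ⟨fun p q h => ?_⟩
        rcases h with ⟨n, i, j, hd, hij, hn, h⟩ | ⟨e, u, v, j, hd, h, hp, hq⟩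
        · exact Or.inl ⟨n, i, j, hd, hij, hn, by tauto⟩
        · exact Or.inr ⟨e, v, u, j, hd, h.symm, hq, hp⟩
      eq_or_eq_of_isLink_of_isLink := by
        intro d x y v w h h'
        rcases h with ⟨n, i, j, rfl, hij, hn, h⟩ | ⟨e, u, u', j, rfl, h, hp, hq⟩ <;>
        rcases h' with ⟨n', i', j', hd', hij', hn', h'⟩ | ⟨e', v', w', j', hd', h', hp', hq'⟩ <;>
        simp only [Sum.inl.injEq, Sum.inr.injEq, Prod.mk.injEq, reduceCtorEq] at hd'
        · obtain ⟨rfl, rfl, rfl⟩ := hd'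
          rcases h with ⟨rfl, rfl⟩ | ⟨rfl, rfl⟩ <;> rcases h' with ⟨rfl, rfl⟩ | ⟨rfl, rfl⟩ <;> simp
        · obtain ⟨he, rfl⟩ := hd'
          obtain rfl := hψ h.edge_mem h'.edge_mem he
          subst hp hp' hq'
          rcases h.left_eq_or_eq h' with rfl | rfl <;> simp
      left_mem_of_isLink := by
        intro d x y h
        rcases h with ⟨n, i, j, rfl, hij, hn, h⟩ | ⟨e, u, u', j, rfl, h, hp, hq⟩
        · rcases h with ⟨rfl, rfl⟩ | ⟨rfl, rfl⟩ <;> exact hn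
        · subst hp
          exact ⟨u, h.left_mem, rfl⟩ }
  have hbetween : ∀ u ∈ V(G), ∀ v ∈ V(G), u ≠ v →
      edgesBetween H {p | p.1 = φ u} {p | p.1 = φ v} =
        ⋃ e ∈ {e | G.IsLink e u v}, {d | ∃ j, d = Sum.inr (ψ e, j)} := by
    intro u hu v hv huv
    have hne : φ u ≠ φ v := fun h => huv (hφ hu hv h)
    ext d
    simp only [Set.mem_iUnion, edgesBetween, Set.mem_ofPred_eq]
    constructor
    · rintro ⟨a, ha, b, hb, h⟩
      rcases h with ⟨n, i, j, rfl, hij, hn, h⟩ | ⟨e, u', v', j, rfl, h, rfl, rfl⟩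
      · exfalso
        rcases h with ⟨rfl, rfl⟩ | ⟨rfl, rfl⟩ <;> exact hne (ha.symm.trans hb)
      · obtain rfl := hφ h.left_mem hu ha
        obtain rfl := hφ h.right_mem hv hb
        exact ⟨e, h, j, rfl⟩
    · rintro ⟨e, he, j, rfl⟩
      exact ⟨(φ u, j), rfl, (φ v, j), rfl, Or.inr ⟨e, u, v, j, rfl, he, rfl, rfl⟩⟩
  have hlist : ∀ n : ℕ, {p : ℕ × Fin m | p.1 = n} = Set.range (fun j : Fin m => (n, j)) := by
    intro n
    ext ⟨a, b⟩
    simp [eq_comm]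
  let 𝓗 : Cover G (ℕ × Fin m) ((ℕ × Fin m × Fin m) ⊕ (ℕ × Fin m)) :=
    { L := fun v => {p | p.1 = φ v}
      H := H
      M := fun e => {d | ∃ j, d = Sum.inr (ψ e, j)}
      finite_L := by
        intro v _
        rw [hlist]
        exact Set.finite_range _
      nonempty_L := fun v _ => ⟨(φ v, ⟨0, hm⟩), rfl⟩
      vertexSet_H := by
        ext p
        simp only [Set.mem_iUnion, Set.mem_ofPred_eq, H, Set.mem_image]
        constructor
        · rintro ⟨v, hv, h⟩
          exact ⟨v, hv, h.symm⟩
        · rintro ⟨v, hv, h⟩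
          exact ⟨v, hv, h.symm⟩
      M_subset := by
        rintro e u v h d ⟨j, rfl⟩
        exact ⟨(φ u, j), rfl, (φ v, j), rfl, Or.inr ⟨e, u, v, j, rfl, h, rfl, rfl⟩⟩
      M_matching := by
        rintro e - d ⟨j, rfl⟩ d' ⟨j', rfl⟩ a ⟨b, h⟩ ⟨b', h'⟩
        rcases h with ⟨_, _, _, hd, _⟩ | ⟨_, _, _, _, hd, _, hp, _⟩
        · cases hd
        rcases h' with ⟨_, _, _, hd', _⟩ | ⟨_, _, _, _, hd', _, hp', _⟩
        · cases hd'
        simp only [Sum.inr.injEq, Prod.mk.injEq] at hd hd'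
        have := congrArg Prod.snd (hp.symm.trans hp')
        simp only at this
        rw [hd.2, hd'.2, this]
      disjoint_L := by
        intro u hu v hv huv
        rw [Set.disjoint_left]
        intro p hp hp'
        exact huv (hφ hu hv (hp.symm.trans hp'))
      loopless_L := by
        intro u hu a ha d h
        rcases h with ⟨n, i, j, rfl, hij, hn, h⟩ | ⟨e, u', v', j, rfl, h, hp, hq⟩
        · rcases h with ⟨rfl, h⟩ | ⟨rfl, h⟩ <;> simp at h <;> exact absurd h (by omega)
        · exact h.ne (hφ h.left_mem h.right_mem (congrArg Prod.fst (hp.symm.trans hq)))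
      complete_L := by
        rintro u hu ⟨a, i⟩ ha ⟨b, j⟩ hb hab
        obtain rfl : a = φ u := ha
        obtain rfl : b = φ u := hb
        have hij : i ≠ j := fun h => hab (by rw [h])
        refine ⟨Sum.inl (φ u, min i j, max i j), ?_, ?_⟩
        · refine Or.inl ⟨_, _, _, rfl, by simpa [eq_comm] using hij, ⟨u, hu, rfl⟩, ?_⟩
          rcases le_total i j with h | h <;> simp [h]
        · intro d h
          rcases h with ⟨n, i', j', rfl, hij', hn, h⟩ | ⟨e, u', v', j', rfl, h, hp, hq⟩
          · simp only [Prod.mk.injEq] at h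
            rcases h with ⟨⟨rfl, rfl⟩, -, rfl⟩ | ⟨⟨rfl, rfl⟩, -, rfl⟩
            · rw [min_eq_left hij'.le, max_eq_right hij'.le]
            · rw [min_eq_right hij'.le, max_eq_left hij'.le]
          · simp only [Prod.mk.injEq] at hp hq
            exact absurd (hp.2.trans hq.2.symm) hij
      disjoint_M := by
        intro e he f hf hef
        rw [Set.disjoint_left]
        rintro d ⟨j, rfl⟩ ⟨j', h⟩
        simp only [Sum.inr.injEq, Prod.mk.injEq] at h
        exact hef (hψ he hf h.1)
      edgesBetween_L := hbetween }
  refine ⟨_, _, _, 𝓗, ⟨?_, ?_⟩, rfl⟩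
  · intro u _
    change ({p : ℕ × Fin m | p.1 = φ u}).ncard = m
    rw [hlist, ← Set.image_univ, Set.ncard_image_of_injective _ (fun i j h => by simpa using h),
      Set.ncard_univ, Nat.card_eq_fintype_card, Fintype.card_fin]
  · intro u hu v hv huv
    change (edgesBetween H {p | p.1 = φ u} {p | p.1 = φ v}).ncard = _
    have himg : edgesBetween H {p | p.1 = φ u} {p | p.1 = φ v} =
        (fun x : β × Fin m => (Sum.inr (ψ x.1, x.2) : (ℕ × Fin m × Fin m) ⊕ (ℕ × Fin m))) ''
          ({e | G.IsLink e u v} ×ˢ Set.univ) := by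
      rw [hbetween u hu v hv huv]
      ext d
      simp only [Set.mem_iUnion, Set.mem_image, Set.mem_prod, Prod.exists, Set.mem_ofPred_eq,
        Set.mem_univ, and_true]
      constructor
      · rintro ⟨e, he, j, rfl⟩
        exact ⟨e, j, he, rfl⟩
      · rintro ⟨e, j, he, rfl⟩
        exact ⟨e, he, j, rfl⟩
    rw [himg, Set.InjOn.ncard_image, Set.ncard_prod, Set.ncard_univ, Nat.card_eq_fintype_card,
      Fintype.card_fin]
    rintro ⟨e, j⟩ ⟨he, -⟩ ⟨e', j'⟩ ⟨he', -⟩ h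
    simp only [Sum.inr.injEq, Prod.mk.injEq] at h
    exact Prod.ext (hψ (Graph.IsLink.edge_mem he) (Graph.IsLink.edge_mem he') h.1) h.2

theorem bddAbove_fullCounts {α β : Type*} (G : Graph α β) (hV : V(G).Finite) (m : ℕ) :
    BddAbove (fullCounts G m) := by
  refine ⟨2 ^ (∑ v ∈ hV.toFinset, m), ?_⟩
  rintro _ ⟨C, D, 𝓗, hfull, rfl⟩
  have hfin : V(𝓗.H).Finite := by
    rw [𝓗.vertexSet_H]
    exact hV.biUnion 𝓗.finite_L
  have hcard : V(𝓗.H).ncard ≤ ∑ v ∈ hV.toFinset, m := by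
    have h : V(𝓗.H) = ⋃ v ∈ hV.toFinset, 𝓗.L v := by
      rw [𝓗.vertexSet_H]
      simp
    rw [h]
    refine (Finset.set_ncard_biUnion_le _ _).trans (Finset.sum_le_sum fun v hv => ?_)
    exact (hfull.1 v (hV.mem_toFinset.1 hv)).le
  have hsub : 𝓗.colorings ⊆ 𝒫 V(𝓗.H) := fun I hI => hI.1
  calc 𝓗.numColorings ≤ (𝒫 V(𝓗.H)).ncard := Set.ncard_le_ncard hsub hfin.finite_subsets
    _ = 2 ^ V(𝓗.H).ncard := Set.ncard_powerset _ hfin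
    _ ≤ _ := Nat.pow_le_pow_right (by norm_num) hcard

theorem isLeast_dpColor {α β : Type*} (G : Graph α β) [G.Loopless] (hV : V(G).Finite)
    (hE : E(G).Finite) (m : ℕ) (hm : 1 ≤ m) : IsLeast (fullCounts G m) (dpColor G m) :=
  ⟨Nat.sInf_mem (fullCounts_nonempty G hV hE m hm), fun _ h => Nat.sInf_le h⟩

theorem isGreatest_dualDPColor {α β : Type*} (G : Graph α β) [G.Loopless] (hV : V(G).Finite)
    (hE : E(G).Finite) (m : ℕ) (hm : 1 ≤ m) : IsGreatest (fullCounts G m) (dualDPColor G m) :=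
  ⟨Nat.sSup_mem (fullCounts_nonempty G hV hE m hm) (bddAbove_fullCounts G hV m),
    fun _ h => le_csSup (bddAbove_fullCounts G hV m) h⟩

end DPColoring

/-!
A full `m`-fold cover of a finite loopless multigraph has perfect matchings only, because the
matchings of parallel edges have at most `m` edges each and their sizes add up to the prescribed
number. After the elements of the lists have been named by `Fin m`, a full cover is therefore a
permutation `π j` of the colours for each oriented edge `j`, and its colourings are the functions
`c` on the vertices with `c (tgt j) ≠ π j (c (src j))`. Conversely all families of permutations
arise (`fullCounts_eq`), so that the extrema are taken over such families.

Let `J` be the all-ones matrix and `P_σ` the matrix of a permutation `σ`. A path with `p` inner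
vertices and with ends coloured `i` and `j` has as many colourings as the entry at `(i, j)` of the
product of the matrices `J - P_{π t}` over its edges says. For odd `p` this product is `c J + P_σ`,
where `m c = (m - 1) ^ (p + 1) - 1` and `σ` is the product of the permutations along the path
(`sum_pathProper`, `mul_pathConst`), and `σ` can be prescribed.

The graph `G` consists of the edge `uv` and of two paths from `u` to `v` with `2k - 1` and `2l - 1`
inner vertices. Let `c`, `d` be their constants, `σ`, `τ` their permutations, and `ρ` that of `uv`.
* `G` has `∑ i, ∑ j ≠ ρ i, (c + [j = σ i]) (d + [j = τ i])` colourings. The sum over `j` is at most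
  `(m - 1) c d + c + d + 1`, with equality if `σ i = τ i ≠ ρ i` (`dualDPColor_theta`).
* For `G - uv` the sum is over all `j`, and is at most `m c d + c + d + 1`, with equality if `σ = τ`
  (`dualDPColor_cycle`).
* For `G · uv` it is over `j = i` only, and is at least `c d`, with equality if `σ` and `τ` have no
  fixed points (`dpColor_twoCycles`).

The third extremum is the difference of the other two, and inserting the values of `c` and `d`
gives the formula.
-/

open scoped Graph

namespace DPColoring

/-! ### Counting colourings along a path -/

section Path

/-- The sequence `a, w 0, …, w (p - 1), b`. -/
def pathSeq {V : Type*} {p : ℕ} (a b : V) (w : Fin p → V) : Fin (p + 2) → V :=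
  Fin.cons a (Fin.snoc w b)

theorem comp_pathSeq {V W : Type*} {p : ℕ} (c : V → W) (a b : V) (w : Fin p → V)
    (t : Fin (p + 2)) : c (pathSeq a b w t) = pathSeq (c a) (c b) (c ∘ w) t := by
  induction t using Fin.cases with
  | zero => rfl
  | succ t =>
    induction t using Fin.lastCases with
    | last => simp [pathSeq]
    | cast t => simp [pathSeq]

@[simp]
theorem pathSeq_zero {V : Type*} {p : ℕ} (a b : V) (w : Fin p → V) : pathSeq a b w 0 = a := rfl

theorem pathSeq_cons {V : Type*} {p : ℕ} (a b x : V) (w : Fin p → V) (t : Fin (p + 2)) :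
    pathSeq a b (Fin.cons x w : Fin (p + 1) → V) t.succ = pathSeq x b w t := by
  have h := Fin.cons_snoc_eq_snoc_cons x w b
  simp only [pathSeq, Fin.cons_succ]
  rw [← h]

variable {m : ℕ}

/-- The product of the permutations along the edges of a path, in the order of traversal. -/
def holonomy : {p : ℕ} → (Fin (p + 1) → Equiv.Perm (Fin m)) → Equiv.Perm (Fin m)
  | 0, π => π 0
  | _ + 1, π => holonomy (Fin.tail π) * π 0

theorem holonomy_one : ∀ {p : ℕ}, holonomy (1 : Fin (p + 1) → Equiv.Perm (Fin m)) = 1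
  | 0 => rfl
  | p + 1 => by
    have h : Fin.tail (1 : Fin (p + 2) → Equiv.Perm (Fin m)) = 1 := rfl
    rw [holonomy, h, holonomy_one, Pi.one_apply, one_mul]

theorem exists_holonomy_eq {p : ℕ} (σ : Equiv.Perm (Fin m)) :
    ∃ π : Fin (p + 1) → Equiv.Perm (Fin m), holonomy π = σ := by
  cases p with
  | zero => exact ⟨fun _ => σ, rfl⟩
  | succ p => exact ⟨Fin.cons σ 1, by rw [holonomy, Fin.tail_cons, holonomy_one]; simp⟩

/-- The number `c` in the transfer matrix `c J ± P_σ` of a path with `p` inner vertices, see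
`sum_pathProper`. -/
def pathConst (m : ℤ) : ℕ → ℤ
  | 0 => 1
  | p + 1 => (m - 1) * pathConst m p + (-1) ^ (p + 1)

theorem mul_pathConst (m : ℤ) (p : ℕ) :
    m * pathConst m p = (m - 1) ^ (p + 1) - (-1) ^ (p + 1) := by
  induction p with
  | zero => simp [pathConst]
  | succ p ih =>
    rw [pathConst, mul_add, mul_left_comm, ih]
    ring

theorem pathConst_nonneg {m : ℤ} (hm : 2 ≤ m) {p : ℕ} (hp : Odd p) : 0 ≤ pathConst m p := by
  have h := mul_pathConst m p
  rw [hp.add_one.neg_one_pow] at h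
  have h1 : 1 ≤ (m - 1) ^ (p + 1) := one_le_pow₀ (by linarith)
  exact nonneg_of_mul_nonneg_right (by linarith) (by linarith : 0 < m)

/-- `w` colours the inner vertices of a path whose ends are coloured `i` and `j`, and the colouring
avoids the matching `x ↦ π t x` along each edge `t` of the path. -/
def PathProper {p : ℕ} (π : Fin (p + 1) → Equiv.Perm (Fin m)) (i j : Fin m) (w : Fin p → Fin m) :
    Prop :=
  ∀ t, pathSeq i j w t.succ ≠ π t (pathSeq i j w t.castSucc)

instance {p : ℕ} (π : Fin (p + 1) → Equiv.Perm (Fin m)) (i j : Fin m) (w : Fin p → Fin m) :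
    Decidable (PathProper π i j w) := by
  unfold PathProper; infer_instance

theorem pathProper_cons {p : ℕ} (π : Fin (p + 2) → Equiv.Perm (Fin m)) (i j x : Fin m)
    (w : Fin p → Fin m) :
    PathProper π i j (Fin.cons x w) ↔ x ≠ π 0 i ∧ PathProper (Fin.tail π) x j w := by
  simp only [PathProper, Fin.forall_fin_succ (n := p + 1), Fin.tail]
  refine and_congr ?_ (forall_congr' fun t => ?_)
  · rw [pathSeq_cons, Fin.castSucc_zero, pathSeq_zero, pathSeq_zero]
  · rw [← Fin.succ_castSucc, pathSeq_cons, pathSeq_cons]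

/-- The transfer matrix of a path: `∏ (J - P_{π t}) = c J + (-1) ^ (p + 1) P_σ`, where `J` is the
all-ones matrix and `σ` the holonomy of the path. -/
theorem sum_pathProper {p : ℕ} (π : Fin (p + 1) → Equiv.Perm (Fin m)) (i j : Fin m) :
    ∑ w, (if PathProper π i j w then (1 : ℤ) else 0) =
      pathConst m p + (-1) ^ (p + 1) * (if j = holonomy π i then 1 else 0) := by
  induction p generalizing i with
  | zero =>
    have h : ∀ w, PathProper π i j w ↔ j ≠ π 0 i := by
      intro w
      simp [PathProper, Fin.forall_fin_one, pathSeq, Fin.snoc]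
    simp only [h, pathConst, holonomy]
    by_cases hj : j = π 0 i <;> simp [hj]
  | succ p ih =>
    rw [← (Fin.consEquiv fun _ => Fin m).sum_comp, Fintype.sum_prod_type]
    have h : ∀ x, ∑ w, (if PathProper π i j (Fin.cons x w) then (1 : ℤ) else 0) =
        (pathConst m p + (-1) ^ (p + 1) * (if j = holonomy (Fin.tail π) x then 1 else 0)) -
        (if x = π 0 i then pathConst m p +
          (-1) ^ (p + 1) * (if j = holonomy (Fin.tail π) x then 1 else 0) else 0) := by
      intro x
      simp only [pathProper_cons]
      by_cases hx : x = π 0 i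
      · simp [hx]
      · simp only [ne_eq, hx, not_false_eq_true, true_and, if_false, sub_zero]
        exact ih _ x
    have hsum : ∑ x, (if j = holonomy (Fin.tail π) x then (1 : ℤ) else 0) = 1 := by
      simp only [← Equiv.symm_apply_eq, Finset.sum_ite_eq, Finset.mem_univ, if_true]
    have hhol : holonomy π i = holonomy (Fin.tail π) (π 0 i) := rfl
    refine (Finset.sum_congr rfl fun x _ => h x).trans ?_
    rw [Finset.sum_sub_distrib, Finset.sum_add_distrib, ← Finset.mul_sum, hsum,
      Finset.sum_ite_eq' Finset.univ]
    simp only [Finset.mem_univ, if_true, Finset.sum_const, Finset.card_univ, Fintype.card_fin,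
      nsmul_eq_mul, pathConst, hhol]
    ring

end Path

/-! ### Full covers as permutations on the edges -/

section Listing

variable {α β C D ι κ : Type*} {G : Graph α β} {m : ℕ}

/-- A listing without repetition of the vertices and of the edges of a loopless multigraph, together
with an orientation of its edges. -/
structure Listing (G : Graph α β) (ι κ : Type*) where
  /-- the vertices -/
  vert : ι → α
  /-- the edges -/
  edge : κ → β
  /-- the tail of an edge -/
  src : κ → ι
  /-- the head of an edge -/
  tgt : κ → ι
  vert_injective : Function.Injective vert
  edge_injective : Function.Injective edge
  vertexSet_eq : V(G) = Set.range vert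
  edgeSet_eq : E(G) = Set.range edge
  isLink : ∀ j, G.IsLink (edge j) (vert (src j)) (vert (tgt j))
  src_ne_tgt : ∀ j, src j ≠ tgt j

/-- The colouring `c` avoids the matching `a ↦ π j a` from the list of the tail to the list of the
head of every edge `j`. -/
def IsProper (src tgt : κ → ι) (π : κ → Equiv.Perm (Fin m)) (c : ι → Fin m) : Prop :=
  ∀ j, c (tgt j) ≠ π j (c (src j))

namespace Listing

variable (Λ : Listing G ι κ)

theorem vert_mem (i : ι) : Λ.vert i ∈ V(G) := by
  rw [Λ.vertexSet_eq]
  exact ⟨i, rfl⟩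

theorem edge_mem (j : κ) : Λ.edge j ∈ E(G) := (Λ.isLink j).edge_mem

theorem isLink_iff {e : β} {i i' : ι} :
    G.IsLink e (Λ.vert i) (Λ.vert i') ↔
      ∃ j, Λ.edge j = e ∧ ((Λ.src j = i ∧ Λ.tgt j = i') ∨ (Λ.src j = i' ∧ Λ.tgt j = i)) := by
  constructor
  · intro h
    have he := h.edge_mem
    rw [Λ.edgeSet_eq] at he
    obtain ⟨j, rfl⟩ := he
    refine ⟨j, rfl, ?_⟩
    rcases (Λ.isLink j).eq_and_eq_or_eq_and_eq h with h | h
    · exact Or.inl ⟨Λ.vert_injective h.1, Λ.vert_injective h.2⟩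
    · exact Or.inr ⟨Λ.vert_injective h.1, Λ.vert_injective h.2⟩
  · rintro ⟨j, rfl, ⟨rfl, rfl⟩ | ⟨rfl, rfl⟩⟩
    · exact Λ.isLink j
    · exact (Λ.isLink j).symm

include Λ in
theorem ncard_vertexSet [Fintype ι] : V(G).ncard = Fintype.card ι := by
  rw [Λ.vertexSet_eq, ← Set.image_univ, Set.ncard_image_of_injective _ Λ.vert_injective,
    Set.ncard_univ, Nat.card_eq_fintype_card]

end Listing

/-- Names `0, …, m - 1` for the elements of the lists of a cover, in terms of which the matching of
the edge `j` is the graph of the permutation `π j`. -/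
structure Labelling (Λ : Listing G ι κ) (𝓗 : Cover G C D) (π : κ → Equiv.Perm (Fin m)) where
  /-- the element of the list of the vertex `i` with a given name -/
  lab : ι → Fin m → C
  lab_injective : ∀ i, Function.Injective (lab i)
  range_lab : ∀ i, Set.range (lab i) = 𝓗.L (Λ.vert i)
  matching : ∀ j a b,
    (∃ d ∈ 𝓗.M (Λ.edge j), 𝓗.H.IsLink d (lab (Λ.src j) a) (lab (Λ.tgt j) b)) ↔ b = π j a

namespace Labelling

variable {Λ : Listing G ι κ} {𝓗 : Cover G C D} {π : κ → Equiv.Perm (Fin m)}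
  (ℓ : Labelling Λ 𝓗 π)

include ℓ

theorem lab_mem (i : ι) (a : Fin m) : ℓ.lab i a ∈ 𝓗.L (Λ.vert i) := by
  rw [← ℓ.range_lab]
  exact ⟨a, rfl⟩

theorem fst_eq_of_lab_eq {i i' : ι} {a a' : Fin m} (h : ℓ.lab i a = ℓ.lab i' a') : i = i' := by
  by_contra hne
  have hd := 𝓗.disjoint_L _ (Λ.vert_mem i) _ (Λ.vert_mem i')
    (fun h => hne (Λ.vert_injective h))
  exact Set.disjoint_left.1 hd (ℓ.lab_mem i a) (h ▸ ℓ.lab_mem i' a')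

theorem mem_vertexSet {x : C} : x ∈ V(𝓗.H) ↔ ∃ i a, ℓ.lab i a = x := by
  rw [𝓗.vertexSet_H]
  simp only [Set.mem_iUnion]
  constructor
  · rintro ⟨v, hv, hx⟩
    rw [Λ.vertexSet_eq] at hv
    obtain ⟨i, rfl⟩ := hv
    rw [← ℓ.range_lab] at hx
    exact ⟨i, hx⟩
  · rintro ⟨i, a, rfl⟩
    exact ⟨_, Λ.vert_mem i, ℓ.lab_mem i a⟩

theorem adj_of_ne {i : ι} {a b : Fin m} (h : a ≠ b) : 𝓗.H.Adj (ℓ.lab i a) (ℓ.lab i b) :=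
  (𝓗.complete_L _ (Λ.vert_mem i) _ (ℓ.lab_mem i a) _ (ℓ.lab_mem i b)
    (fun h' => h (ℓ.lab_injective i h'))).exists

theorem injective_transversal (c : ι → Fin m) : Function.Injective fun i => ℓ.lab i (c i) :=
  fun _ _ h => ℓ.fst_eq_of_lab_eq h

theorem mem_colorings_of_isProper [Fintype ι] {c : ι → Fin m} (hc : IsProper Λ.src Λ.tgt π c) :
    Set.range (fun i => ℓ.lab i (c i)) ∈ 𝓗.colorings := by
  refine ⟨?_, ?_, ?_⟩
  · rintro _ ⟨i, rfl⟩
    exact ℓ.mem_vertexSet.2 ⟨i, c i, rfl⟩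
  · rintro _ ⟨i, rfl⟩ _ ⟨i', rfl⟩ ⟨d, hd⟩
    by_cases hi : i = i'
    · subst hi
      exact 𝓗.loopless_L _ (Λ.vert_mem i) _ (ℓ.lab_mem i _) d hd
    · have hmem : d ∈ edgesBetween 𝓗.H (𝓗.L (Λ.vert i)) (𝓗.L (Λ.vert i')) :=
        ⟨_, ℓ.lab_mem i _, _, ℓ.lab_mem i' _, hd⟩
      rw [𝓗.edgesBetween_L _ (Λ.vert_mem i) _ (Λ.vert_mem i')
        (fun h => hi (Λ.vert_injective h))] at hmem
      simp only [Set.mem_iUnion, Set.mem_ofPred_eq] at hmem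
      obtain ⟨e, he, hde⟩ := hmem
      obtain ⟨j, rfl, ⟨rfl, rfl⟩ | ⟨rfl, rfl⟩⟩ := Λ.isLink_iff.1 he
      · exact hc j ((ℓ.matching j _ _).1 ⟨d, hde, hd⟩)
      · exact hc j ((ℓ.matching j _ _).1 ⟨d, hde, hd.symm⟩)
  · rw [← Set.image_univ, Set.ncard_image_of_injective _ (ℓ.injective_transversal c),
      Set.ncard_univ, Nat.card_eq_fintype_card, Λ.ncard_vertexSet]

/-- An independent set of size `|V(G)|` meets every list, because it meets each at most once. -/
theorem exists_isProper_of_mem_colorings [Fintype ι] {I : Set C} (hI : I ∈ 𝓗.colorings) :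
    ∃ c, IsProper Λ.src Λ.tgt π c ∧ Set.range (fun i => ℓ.lab i (c i)) = I := by
  obtain ⟨hsub, hind, hcard⟩ := hI
  rw [Λ.ncard_vertexSet] at hcard
  have hIV : ∀ x ∈ I, ∃ i a, ℓ.lab i a = x := fun x hx => ℓ.mem_vertexSet.1 (hsub hx)
  choose idx col hlab using hIV
  have hsurj := Set.surj_on_of_inj_on_of_ncard_le (t := (Set.univ : Set ι)) idx
    (fun _ _ => Set.mem_univ _) (by
      intro x y hx hy hxy
      by_contra hne
      have hcol : col x hx ≠ col y hy := fun h => hne (by rw [← hlab x hx, ← hlab y hy, hxy, h])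
      have hadj := ℓ.adj_of_ne (i := idx x hx) hcol
      rw [hlab x hx, hxy, hlab y hy] at hadj
      exact hind x hx y hy hadj)
    (by rw [hcard, Set.ncard_univ, Nat.card_eq_fintype_card])
  have hex : ∀ i, ∃ a, ℓ.lab i a ∈ I := by
    intro i
    obtain ⟨x, hx, rfl⟩ := hsurj i (Set.mem_univ _)
    exact ⟨col x hx, by rwa [hlab x hx]⟩
  choose c hc using hex
  refine ⟨c, ?_, ?_⟩
  · intro j hj
    obtain ⟨d, -, hd⟩ := (ℓ.matching j _ _).2 hj
    exact hind _ (hc _) _ (hc _) ⟨d, hd⟩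
  · refine Set.eq_of_subset_of_ncard_le (Set.range_subset_iff.2 hc) ?_ ?_
    · rw [hcard, ← Set.image_univ, Set.ncard_image_of_injective _ (ℓ.injective_transversal c),
        Set.ncard_univ, Nat.card_eq_fintype_card]
    · refine Set.Finite.subset (Set.finite_range fun x : ι × Fin m => ℓ.lab x.1 x.2) ?_
      intro x hx
      exact ⟨(idx x hx, col x hx), hlab x hx⟩

theorem numColorings_eq [Fintype ι] :
    𝓗.numColorings = {c | IsProper Λ.src Λ.tgt π c}.ncard := by
  have h : 𝓗.colorings =
      (fun (c : ι → Fin m) => Set.range fun i => ℓ.lab i (c i)) ''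
        {c | IsProper Λ.src Λ.tgt π c} := by
    ext I
    constructor
    · intro hI
      exact ℓ.exists_isProper_of_mem_colorings hI
    · rintro ⟨c, hc, rfl⟩
      exact ℓ.mem_colorings_of_isProper hc
  rw [Cover.numColorings, h]
  refine Set.ncard_image_of_injective _ fun c c' hcc => funext fun i => ?_
  have hi : ℓ.lab i (c i) ∈ Set.range fun i => ℓ.lab i (c' i) := hcc ▸ ⟨i, rfl⟩
  obtain ⟨i', hi'⟩ := hi
  obtain rfl := ℓ.fst_eq_of_lab_eq hi'
  exact (ℓ.lab_injective _ hi').symm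

end Labelling

/-- In a full cover of a finite multigraph every matching is perfect. -/
theorem Cover.IsFull.ncard_M [Finite κ] (Λ : Listing G ι κ) {𝓗 : Cover G C D} (h : 𝓗.IsFull m)
    (j : κ) : (𝓗.M (Λ.edge j)).ncard = m := by
  have hle : ∀ e u v, G.IsLink e u v → (𝓗.M e).ncard ≤ m := by
    intro e u v he
    have : Nonempty C := (𝓗.nonempty_L u he.left_mem).to_type
    have hsub : ∀ d ∈ 𝓗.M e, ∃ a, a ∈ 𝓗.L u ∧ 𝓗.H.Inc d a := by
      intro d hd
      obtain ⟨a, ha, b, -, hab⟩ := 𝓗.M_subset e u v he hd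
      exact ⟨a, ha, b, hab⟩
    choose! a ha hinc using hsub
    rw [← h.1 u he.left_mem]
    refine Set.ncard_le_ncard_of_injOn a ha ?_ (𝓗.finite_L u he.left_mem)
    intro d hd d' hd' hdd
    exact 𝓗.M_matching e he.edge_mem d hd d' hd' (a d) (hinc d hd) (hdd ▸ hinc d' hd')
  set u := Λ.vert (Λ.src j) with hu
  set v := Λ.vert (Λ.tgt j) with hv
  have huv : u ≠ v := fun h => Λ.src_ne_tgt j (Λ.vert_injective h)
  have hfin : {e | G.IsLink e u v}.Finite := by
    refine (Set.finite_range Λ.edge).subset fun e he => ?_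
    rw [← Λ.edgeSet_eq]
    exact Graph.IsLink.edge_mem he
  have hcard := h.2 u (Λ.vert_mem _) v (Λ.vert_mem _) huv
  rw [𝓗.edgesBetween_L u (Λ.vert_mem _) v (Λ.vert_mem _) huv] at hcard
  have hle' : ∀ e ∈ hfin.toFinset, (𝓗.M e).ncard ≤ m := fun e he =>
    hle e u v (hfin.mem_toFinset.1 he)
  have hunion := Finset.set_ncard_biUnion_le hfin.toFinset 𝓗.M
  simp only [Set.Finite.mem_toFinset] at hunion
  rw [hcard, Set.ncard_eq_toFinset_card _ hfin, ← smul_eq_mul, ← Finset.sum_const] at hunion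
  exact (Finset.sum_eq_sum_iff_of_le hle').1 (le_antisymm (Finset.sum_le_sum hle') hunion) _
    (hfin.mem_toFinset.2 (Λ.isLink j))

theorem Cover.IsFull.exists_labelling [Finite κ] (Λ : Listing G ι κ) {𝓗 : Cover G C D}
    (h : 𝓗.IsFull m) : ∃ π : κ → Equiv.Perm (Fin m), Nonempty (Labelling Λ 𝓗 π) := by
  have hlab : ∀ i, ∃ f : Fin m → C, Function.Injective f ∧ Set.range f = 𝓗.L (Λ.vert i) := by
    intro i
    have := (𝓗.finite_L _ (Λ.vert_mem i)).to_subtype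
    have hc : Nat.card (𝓗.L (Λ.vert i)) = m := h.1 _ (Λ.vert_mem i)
    let φ := (Finite.equivFinOfCardEq hc).symm
    exact ⟨fun a => φ a, Subtype.val_injective.comp φ.injective, by
      rw [show (fun a => (φ a : C)) = Subtype.val ∘ φ from rfl, Set.range_comp,
        φ.surjective.range_eq, Set.image_univ, Subtype.range_coe]⟩
  choose lab hinj hrange using hlab
  have hmem : ∀ i a, lab i a ∈ 𝓗.L (Λ.vert i) := fun i a => hrange i ▸ ⟨a, rfl⟩
  have hperm : ∀ j, ∃ σ : Equiv.Perm (Fin m), ∀ a b,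
      (∃ d ∈ 𝓗.M (Λ.edge j), 𝓗.H.IsLink d (lab (Λ.src j) a) (lab (Λ.tgt j) b)) ↔ b = σ a := by
    intro j
    have hends : ∀ d ∈ 𝓗.M (Λ.edge j), ∃ a b,
        𝓗.H.IsLink d (lab (Λ.src j) a) (lab (Λ.tgt j) b) := by
      intro d hd
      obtain ⟨x, hx, y, hy, hxy⟩ := 𝓗.M_subset _ _ _ (Λ.isLink j) hd
      rw [← hrange] at hx hy
      obtain ⟨a, rfl⟩ := hx
      obtain ⟨b, rfl⟩ := hy
      exact ⟨a, b, hxy⟩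
    choose s t hst using hends
    have hsurj := Set.surj_on_of_inj_on_of_ncard_le (t := (Set.univ : Set (Fin m))) s
      (fun _ _ => Set.mem_univ _) (fun d d' hd hd' hdd =>
        𝓗.M_matching _ (Λ.edge_mem j) d hd d' hd' _ ⟨_, hst d hd⟩ (hdd ▸ ⟨_, hst d' hd'⟩))
      (by rw [h.ncard_M Λ, Set.ncard_univ, Nat.card_eq_fintype_card, Fintype.card_fin])
    have hf : ∀ a, ∃ b, ∃ d ∈ 𝓗.M (Λ.edge j),
        𝓗.H.IsLink d (lab (Λ.src j) a) (lab (Λ.tgt j) b) := by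
      intro a
      obtain ⟨d, hd, rfl⟩ := hsurj a (Set.mem_univ _)
      exact ⟨t d hd, d, hd, hst d hd⟩
    choose f d hd hdf using hf
    have hfinj : Function.Injective f := by
      intro a a' haa
      have hdd := 𝓗.M_matching _ (Λ.edge_mem j) _ (hd a) _ (hd a') (lab (Λ.tgt j) (f a))
        ⟨_, (hdf a).symm⟩ (haa ▸ ⟨_, (hdf a').symm⟩)
      have h1 := hdf a
      rw [hdd, haa] at h1
      exact hinj _ (h1.left_unique (hdf a'))
    refine ⟨Equiv.ofBijective f (Finite.injective_iff_bijective.1 hfinj), fun a b => ⟨?_, ?_⟩⟩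
    · rintro ⟨d', hd', hl⟩
      have hdd := 𝓗.M_matching _ (Λ.edge_mem j) _ (hd a) _ hd' (lab (Λ.src j) a)
        ⟨_, hdf a⟩ ⟨_, hl⟩
      rw [← hdd] at hl
      exact hinj _ (hl.right_unique (hdf a))
    · rintro rfl
      exact ⟨d a, hd a, hdf a⟩
  choose π hπ using hperm
  exact ⟨π, ⟨⟨lab, hinj, hrange, hπ⟩⟩⟩

end Listing

/-! ### The cover given by permutations on the edges -/

section PermCover

variable {α β : Type*} {ι κ : Type} {G : Graph α β} {m : ℕ}

/-- The cover graph of a family `π` of permutations: the list of the vertex `i` is `{i} × Fin m`, and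
the edge `j` contributes the edges from `(src j, a)` to `(tgt j, π j a)`. A pair `z` is an edge of
the first kind if its two members are distinct and lie in the same list. -/
def permCoverGraph (src tgt : κ → ι) (π : κ → Equiv.Perm (Fin m)) :
    Graph (ι × Fin m) (Sym2 (ι × Fin m) ⊕ (κ × Fin m)) where
  vertexSet := Set.univ
  IsLink d x y :=
    d.elim (fun z => z = s(x, y) ∧ x.1 = y.1 ∧ x ≠ y)
      (fun z => s((src z.1, z.2), (tgt z.1, π z.1 z.2)) = s(x, y))
  isLink_symm := by
    rintro (z | z) -
    · exact ⟨fun x y h => ⟨h.1.trans Sym2.eq_swap, h.2.1.symm, h.2.2.symm⟩⟩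
    · exact ⟨fun x y h => Eq.trans h Sym2.eq_swap⟩
  eq_or_eq_of_isLink_of_isLink := by
    rintro (z | z) x y x' y' h h'
    · have := h.1.symm.trans h'.1
      rw [Sym2.eq_iff] at this
      tauto
    · have := (Eq.symm h).trans h'
      rw [Sym2.eq_iff] at this
      tauto
  left_mem_of_isLink := fun _ _ _ _ => Set.mem_univ _

theorem permCoverGraph_isLink_inr {src tgt : κ → ι} {π : κ → Equiv.Perm (Fin m)} {j : κ}
    {a : Fin m} {x y : ι × Fin m} :
    (permCoverGraph src tgt π).IsLink (Sum.inr (j, a)) x y ↔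
      (x = (src j, a) ∧ y = (tgt j, π j a)) ∨ (x = (tgt j, π j a) ∧ y = (src j, a)) := by
  change s((src j, a), (tgt j, π j a)) = s(x, y) ↔ _
  rw [Sym2.eq_iff]
  tauto

theorem edgesBetween_permCoverGraph (Λ : Listing G ι κ) (π : κ → Equiv.Perm (Fin m)) {u v : α}
    (huv : u ≠ v) :
    edgesBetween (permCoverGraph Λ.src Λ.tgt π) {x | Λ.vert x.1 = u} {x | Λ.vert x.1 = v} =
      Sum.inr '' ({j | G.IsLink (Λ.edge j) u v} ×ˢ Set.univ) := by
  ext d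
  constructor
  · rintro ⟨x, rfl, y, rfl, h⟩
    rcases d with z | ⟨j, a⟩
    · exact absurd (congrArg Λ.vert h.2.1) huv
    · refine ⟨(j, a), ⟨?_, Set.mem_univ _⟩, rfl⟩
      rcases permCoverGraph_isLink_inr.1 h with ⟨rfl, rfl⟩ | ⟨rfl, rfl⟩
      · exact Λ.isLink j
      · exact (Λ.isLink j).symm
  · rintro ⟨⟨j, a⟩, ⟨h, -⟩, rfl⟩
    rcases (Λ.isLink j).eq_and_eq_or_eq_and_eq h with ⟨h1, h2⟩ | ⟨h1, h2⟩
    · exact ⟨(Λ.src j, a), h1, (Λ.tgt j, π j a), h2,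
        permCoverGraph_isLink_inr.2 (Or.inl ⟨rfl, rfl⟩)⟩
    · exact ⟨(Λ.tgt j, π j a), h2, (Λ.src j, a), h1,
        permCoverGraph_isLink_inr.2 (Or.inr ⟨rfl, rfl⟩)⟩

/-- The cover whose matchings are the graphs of the permutations `π j`. -/
def permCover (Λ : Listing G ι κ) [Finite ι] (hm : 1 ≤ m) (π : κ → Equiv.Perm (Fin m)) :
    Cover G (ι × Fin m) (Sym2 (ι × Fin m) ⊕ (κ × Fin m)) where
  L v := {x | Λ.vert x.1 = v}
  H := permCoverGraph Λ.src Λ.tgt π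
  M e := Sum.inr '' {z | Λ.edge z.1 = e}
  finite_L _ _ := Set.toFinite _
  nonempty_L v hv := by
    rw [Λ.vertexSet_eq] at hv
    obtain ⟨i, rfl⟩ := hv
    exact ⟨(i, ⟨0, hm⟩), rfl⟩
  vertexSet_H := by
    symm
    refine Set.eq_univ_of_forall fun x => ?_
    simp only [Set.mem_iUnion]
    exact ⟨_, Λ.vert_mem x.1, rfl⟩
  M_subset := by
    rintro e u v he _ ⟨⟨j, a⟩, rfl, rfl⟩
    have huv : u ≠ v := by
      rintro rfl
      rcases (Λ.isLink j).eq_and_eq_or_eq_and_eq he with ⟨h1, h2⟩ | ⟨h1, h2⟩ <;>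
        exact Λ.src_ne_tgt j (Λ.vert_injective (h1.trans h2.symm))
    rw [edgesBetween_permCoverGraph Λ π huv]
    exact ⟨(j, a), ⟨he, Set.mem_univ _⟩, rfl⟩
  M_matching := by
    rintro _ - _ ⟨⟨j, a⟩, rfl, rfl⟩ _ ⟨⟨j', a'⟩, hj, rfl⟩ x ⟨y, hy⟩ ⟨y', hy'⟩
    obtain rfl := Λ.edge_injective hj
    have hne := Λ.src_ne_tgt j'
    rcases permCoverGraph_isLink_inr.1 hy with ⟨rfl, -⟩ | ⟨rfl, -⟩ <;>
    rcases permCoverGraph_isLink_inr.1 hy' with ⟨h, -⟩ | ⟨h, -⟩ <;>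
    simp only [Prod.mk.injEq, EmbeddingLike.apply_eq_iff_eq] at h
    · rw [h.2]
    · exact absurd h.1 hne
    · exact absurd h.1.symm hne
    · rw [h.2]
  disjoint_L := by
    intro u _ v _ huv
    rw [Set.disjoint_left]
    intro x hx hx'
    exact huv (Eq.trans (Eq.symm hx) hx')
  loopless_L := by
    rintro _ - x - (z | ⟨j, a⟩) h
    · exact h.2.2 rfl
    · rcases permCoverGraph_isLink_inr.1 h with ⟨rfl, h⟩ | ⟨rfl, h⟩
      · exact Λ.src_ne_tgt j (congrArg Prod.fst h)
      · exact Λ.src_ne_tgt j (congrArg Prod.fst h).symm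
  complete_L := by
    rintro _ - x rfl y hy hxy
    have hy : y.1 = x.1 := Λ.vert_injective hy
    refine ⟨Sum.inl s(x, y), ⟨rfl, hy.symm, hxy⟩, ?_⟩
    rintro (z | ⟨j, a⟩) h
    · exact congrArg Sum.inl h.1
    · exfalso
      rcases permCoverGraph_isLink_inr.1 h with ⟨rfl, rfl⟩ | ⟨rfl, rfl⟩
      · exact Λ.src_ne_tgt j hy.symm
      · exact Λ.src_ne_tgt j hy
  disjoint_M := by
    intro e _ f _ hef
    rw [Set.disjoint_left]
    rintro _ ⟨z, rfl, rfl⟩ ⟨z', rfl, h⟩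
    exact hef (by rw [Sum.inr_injective h])
  edgesBetween_L := by
    intro u _ v _ huv
    rw [edgesBetween_permCoverGraph Λ π huv]
    ext d
    simp only [Set.mem_iUnion, Set.mem_ofPred_eq]
    constructor
    · rintro ⟨z, ⟨hz, -⟩, rfl⟩
      exact ⟨_, hz, z, rfl, rfl⟩
    · rintro ⟨_, he, z, rfl, rfl⟩
      exact ⟨z, ⟨he, Set.mem_univ _⟩, rfl⟩

theorem permCover_isFull (Λ : Listing G ι κ) [Finite ι] (hm : 1 ≤ m)
    (π : κ → Equiv.Perm (Fin m)) : (permCover Λ hm π).IsFull m := by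
  constructor
  · intro u hu
    rw [Λ.vertexSet_eq] at hu
    obtain ⟨i, rfl⟩ := hu
    have h : {x : ι × Fin m | Λ.vert x.1 = Λ.vert i} = {i} ×ˢ Set.univ := by
      ext x
      simp [Λ.vert_injective.eq_iff]
    change ({x : ι × Fin m | Λ.vert x.1 = Λ.vert i}).ncard = m
    rw [h, Set.ncard_prod, Set.ncard_singleton, Set.ncard_univ, one_mul, Nat.card_eq_fintype_card,
      Fintype.card_fin]
  · intro u _ v _ huv
    have h : {e | G.IsLink e u v} = Λ.edge '' {j | G.IsLink (Λ.edge j) u v} := by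
      ext e
      constructor
      · intro he
        have he' := Graph.IsLink.edge_mem he
        rw [Λ.edgeSet_eq] at he'
        obtain ⟨j, rfl⟩ := he'
        exact ⟨j, he, rfl⟩
      · rintro ⟨j, hj, rfl⟩
        exact hj
    rw [h, Set.ncard_image_of_injective _ Λ.edge_injective]
    change (edgesBetween (permCoverGraph Λ.src Λ.tgt π) {x | Λ.vert x.1 = u}
      {x | Λ.vert x.1 = v}).ncard = _
    rw [edgesBetween_permCoverGraph Λ π huv, Set.ncard_image_of_injective _ Sum.inr_injective,
      Set.ncard_prod, Set.ncard_univ, Nat.card_eq_fintype_card, Fintype.card_fin]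

/-- The evident names for the elements of the lists of `permCover`. -/
def permCoverLabelling (Λ : Listing G ι κ) [Finite ι] (hm : 1 ≤ m) (π : κ → Equiv.Perm (Fin m)) :
    Labelling Λ (permCover Λ hm π) π where
  lab i a := (i, a)
  lab_injective i := Prod.mk_right_injective i
  range_lab i := by
    ext x
    constructor
    · rintro ⟨a, rfl⟩
      rfl
    · intro hx
      exact ⟨x.2, Prod.ext (Λ.vert_injective (Eq.symm hx)) rfl⟩
  matching j a b := by
    constructor
    · rintro ⟨_, ⟨⟨j', a'⟩, hj, rfl⟩, h⟩
      obtain rfl := Λ.edge_injective hj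
      rcases permCoverGraph_isLink_inr.1 h with ⟨h1, h2⟩ | ⟨h1, -⟩
      · obtain rfl : a = a' := congrArg Prod.snd h1
        exact congrArg Prod.snd h2
      · exact absurd (congrArg Prod.fst h1) (Λ.src_ne_tgt _)
    · rintro rfl
      exact ⟨Sum.inr (j, a), ⟨(j, a), rfl, rfl⟩,
        permCoverGraph_isLink_inr.2 (Or.inl ⟨rfl, rfl⟩)⟩

/-- Full `m`-fold covers of a finite loopless multigraph are, up to isomorphism, families of
permutations of `m` colours indexed by its edges. -/
theorem fullCounts_eq [Fintype ι] [Finite κ] (Λ : Listing G ι κ) (hm : 1 ≤ m) :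
    fullCounts G m =
      Set.range fun π : κ → Equiv.Perm (Fin m) => {c | IsProper Λ.src Λ.tgt π c}.ncard := by
  ext n
  constructor
  · rintro ⟨C, D, 𝓗, hfull, rfl⟩
    obtain ⟨π, ⟨ℓ⟩⟩ := hfull.exists_labelling Λ
    exact ⟨π, ℓ.numColorings_eq.symm⟩
  · rintro ⟨π, rfl⟩
    exact ⟨_, _, permCover Λ hm π, permCover_isFull Λ hm π,
      (permCoverLabelling Λ hm π).numColorings_eq⟩

end PermCover

/-! ### Two paths with common ends -/

section TwoPaths

variable {T X : Type} {p q m : ℕ}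

/-- The tails of the edges of the graph formed by two paths from `a` to `b` with `p` and `q` inner
vertices and by the edges from `s x` to `t x`. Its vertices are those of `T`, which contains `a` and
`b`, and the inner vertices of the two paths. For `a = b` the paths become closed. -/
def twoPathsSrc (a b : T) (s : X → T) :
    X ⊕ (Fin (p + 1) ⊕ Fin (q + 1)) → T ⊕ (Fin p ⊕ Fin q) :=
  Sum.elim (Sum.inl ∘ s) (Sum.elim
    (fun i => pathSeq (Sum.inl a) (Sum.inl b) (Sum.inr ∘ Sum.inl) i.castSucc)
    (fun i => pathSeq (Sum.inl a) (Sum.inl b) (Sum.inr ∘ Sum.inr) i.castSucc))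

/-- The heads of the edges whose tails are given by `twoPathsSrc`. -/
def twoPathsTgt (a b : T) (t : X → T) :
    X ⊕ (Fin (p + 1) ⊕ Fin (q + 1)) → T ⊕ (Fin p ⊕ Fin q) :=
  Sum.elim (Sum.inl ∘ t) (Sum.elim
    (fun i => pathSeq (Sum.inl a) (Sum.inl b) (Sum.inr ∘ Sum.inl) i.succ)
    (fun i => pathSeq (Sum.inl a) (Sum.inl b) (Sum.inr ∘ Sum.inr) i.succ))

theorem isProper_twoPaths {a b : T} {s t : X → T}
    {π : X ⊕ (Fin (p + 1) ⊕ Fin (q + 1)) → Equiv.Perm (Fin m)} {c : T ⊕ (Fin p ⊕ Fin q) → Fin m} :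
    IsProper (twoPathsSrc a b s) (twoPathsTgt a b t) π c ↔
      (∀ x, c (Sum.inl (t x)) ≠ π (Sum.inl x) (c (Sum.inl (s x)))) ∧
      PathProper (fun i => π (Sum.inr (Sum.inl i))) (c (Sum.inl a)) (c (Sum.inl b))
        (fun i => c (Sum.inr (Sum.inl i))) ∧
      PathProper (fun i => π (Sum.inr (Sum.inr i))) (c (Sum.inl a)) (c (Sum.inl b))
        (fun i => c (Sum.inr (Sum.inr i))) := by
  simp only [IsProper, Sum.forall, twoPathsSrc, twoPathsTgt, Sum.elim_inl, Sum.elim_inr,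
    Function.comp_apply, comp_pathSeq, PathProper]
  rfl

/-- The number of colourings, summed over the colours `z` of the vertices in `T`. -/
theorem ncard_isProper_twoPaths [Fintype T] [DecidableEq T] [Fintype X] (hp : Odd p) (hq : Odd q)
    (a b : T) (s t : X → T) (π : X ⊕ (Fin (p + 1) ⊕ Fin (q + 1)) → Equiv.Perm (Fin m)) :
    ({c | IsProper (twoPathsSrc a b s) (twoPathsTgt a b t) π c}.ncard : ℤ) =
      ∑ z : T → Fin m, if ∀ x, z (t x) ≠ π (Sum.inl x) (z (s x)) then
        (pathConst m p + if z b = holonomy (fun i => π (Sum.inr (Sum.inl i))) (z a) then 1 else 0) *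
        (pathConst m q + if z b = holonomy (fun i => π (Sum.inr (Sum.inr i))) (z a) then 1 else 0)
      else 0 := by
  classical
  have h1 := fun i j => sum_pathProper (fun i => π (Sum.inr (Sum.inl i))) i j
  have h2 := fun i j => sum_pathProper (fun i => π (Sum.inr (Sum.inr i))) i j
  simp only [hp.add_one.neg_one_pow, hq.add_one.neg_one_pow, one_mul] at h1 h2
  simp only [← h1, ← h2, Finset.sum_mul_sum]
  rw [Set.ncard_eq_toFinset_card', Set.toFinset_ofPred, Finset.card_filter, Nat.cast_sum,
    ← (Equiv.sumArrowEquivProdArrow _ _ _).symm.sum_comp, Fintype.sum_prod_type]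
  refine Finset.sum_congr rfl fun z _ => ?_
  rw [← (Equiv.sumArrowEquivProdArrow _ _ _).symm.sum_comp, Fintype.sum_prod_type]
  by_cases hz : ∀ x, z (t x) ≠ π (Sum.inl x) (z (s x))
  · rw [if_pos hz]
    refine Finset.sum_congr rfl fun w₁ _ => Finset.sum_congr rfl fun w₂ _ => ?_
    rw [ite_zero_mul_ite_zero, mul_one, Nat.cast_ite, Nat.cast_one, Nat.cast_zero]
    exact if_congr (isProper_twoPaths.trans (and_iff_right hz)) rfl rfl
  · rw [if_neg hz]
    refine Finset.sum_eq_zero fun w₁ _ => Finset.sum_eq_zero fun w₂ _ => ?_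
    rw [Nat.cast_eq_zero]
    exact if_neg fun h => hz (isProper_twoPaths.1 h).1

end TwoPaths

/-! ### The extremal values -/

section Extremal

variable {m : ℕ} {c d : ℤ}

theorem sum_le_mul {f : Fin m → ℤ} {K : ℤ} (h : ∀ i, f i ≤ K) : ∑ i, f i ≤ m * K :=
  (Finset.sum_le_card_nsmul _ _ _ fun i _ => h i).trans_eq (by simp)

theorem mul_le_sum {f : Fin m → ℤ} {K : ℤ} (h : ∀ i, K ≤ f i) : m * K ≤ ∑ i, f i :=
  Eq.trans_le (by simp) (Finset.card_nsmul_le_sum _ _ _ fun i _ => h i)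

theorem sum_eq_mul {f : Fin m → ℤ} {K : ℤ} (h : ∀ i, f i = K) : ∑ i, f i = m * K :=
  (Finset.sum_eq_card_nsmul fun i _ => h i).trans (by simp)

theorem sum_mul_indicator (c d : ℤ) (s t : Fin m) :
    ∑ j, (c + if j = s then 1 else 0) * (d + if j = t then 1 else 0) =
      m * (c * d) + c + d + if s = t then 1 else 0 := by
  simp only [add_mul, mul_add, Finset.sum_add_distrib, mul_ite, ite_mul, mul_one, mul_zero, one_mul,
    zero_mul, Finset.sum_ite_eq', Finset.mem_univ, if_true, Finset.sum_const, Finset.card_univ,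
    Fintype.card_fin, nsmul_eq_mul, eq_comm (a := t)]
  ring

theorem sum_mul_indicator_le (c d : ℤ) (s t : Fin m) :
    ∑ j, (c + if j = s then 1 else 0) * (d + if j = t then 1 else 0) ≤
      m * (c * d) + c + d + 1 := by
  rw [sum_mul_indicator]
  gcongr
  split_ifs <;> simp

theorem le_mul_indicator (hc : 0 ≤ c) (hd : 0 ≤ d) (P Q : Prop) [Decidable P] [Decidable Q] :
    c * d ≤ (c + if P then 1 else 0) * (d + if Q then 1 else 0) := by
  gcongr <;> split_ifs <;> simp

theorem sum_ite_ne (f : Fin m → ℤ) (r : Fin m) :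
    ∑ j, (if j ≠ r then f j else 0) = ∑ j, f j - f r := by
  rw [← Finset.sum_filter, Finset.filter_ne', Finset.sum_erase_eq_sub (Finset.mem_univ r)]

theorem sum_ite_ne_le (hc : 0 ≤ c) (hd : 0 ≤ d) (r s t : Fin m) :
    ∑ j, (if j ≠ r then (c + if j = s then 1 else 0) * (d + if j = t then 1 else 0) else 0) ≤
      (m - 1) * (c * d) + c + d + 1 := by
  rw [sum_ite_ne]
  linarith [sum_mul_indicator_le c d s t, le_mul_indicator hc hd (r = s) (r = t)]

theorem sum_ite_ne_eq (c d : ℤ) {r s : Fin m} (h : s ≠ r) :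
    ∑ j, (if j ≠ r then (c + if j = s then 1 else 0) * (d + if j = s then 1 else 0) else 0) =
      (m - 1) * (c * d) + c + d + 1 := by
  rw [sum_ite_ne, sum_mul_indicator, if_neg h.symm]
  simp
  ring

theorem exists_derangement (hm : 2 ≤ m) : ∃ σ : Equiv.Perm (Fin m), ∀ i, σ i ≠ i := by
  obtain ⟨n, rfl⟩ := Nat.exists_eq_add_of_le' hm
  refine ⟨finRotate (n + 2), fun i => ?_⟩
  rw [finRotate_apply]
  simp

variable {α β : Type*} {G : Graph α β} {ι κ : Type} [Fintype ι] [Finite κ]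

theorem dualDPColor_eq (Λ : Listing G ι κ) (hm : 1 ≤ m) {N : ℤ}
    (hle : ∀ π : κ → Equiv.Perm (Fin m), ({c | IsProper Λ.src Λ.tgt π c}.ncard : ℤ) ≤ N)
    (hex : ∃ π : κ → Equiv.Perm (Fin m), ({c | IsProper Λ.src Λ.tgt π c}.ncard : ℤ) = N) :
    (dualDPColor G m : ℤ) = N := by
  obtain ⟨π, hπ⟩ := hex
  have h : IsGreatest (fullCounts G m) {c | IsProper Λ.src Λ.tgt π c}.ncard := by
    rw [fullCounts_eq Λ hm]
    refine ⟨⟨π, rfl⟩, ?_⟩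
    rintro _ ⟨π', rfl⟩
    exact_mod_cast (hle π').trans hπ.ge
  rw [dualDPColor, h.csSup_eq, hπ]

theorem dpColor_eq (Λ : Listing G ι κ) (hm : 1 ≤ m) {N : ℤ}
    (hle : ∀ π : κ → Equiv.Perm (Fin m), N ≤ ({c | IsProper Λ.src Λ.tgt π c}.ncard : ℤ))
    (hex : ∃ π : κ → Equiv.Perm (Fin m), ({c | IsProper Λ.src Λ.tgt π c}.ncard : ℤ) = N) :
    (dpColor G m : ℤ) = N := by
  obtain ⟨π, hπ⟩ := hex
  have h : IsLeast (fullCounts G m) {c | IsProper Λ.src Λ.tgt π c}.ncard := by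
    rw [fullCounts_eq Λ hm]
    refine ⟨⟨π, rfl⟩, ?_⟩
    rintro _ ⟨π', rfl⟩
    exact_mod_cast hπ.le.trans (hle π')
  rw [dpColor, h.csInf_eq, hπ]

variable {p q : ℕ}

/-- Two paths with an odd number of inner vertices and an edge between their ends. The maximum is
attained when the two paths have the same holonomy, which moves every colour, and the matching of
the edge is the identity. -/
theorem dualDPColor_theta (hp : Odd p) (hq : Odd q) (hm : 2 ≤ m)
    (Λ : Listing G (Fin 2 ⊕ (Fin p ⊕ Fin q)) (Unit ⊕ (Fin (p + 1) ⊕ Fin (q + 1))))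
    (hsrc : Λ.src = twoPathsSrc 0 1 fun _ => 0) (htgt : Λ.tgt = twoPathsTgt 0 1 fun _ => 1) :
    (dualDPColor G m : ℤ) = m * ((m - 1) * (pathConst m p * pathConst m q) +
      pathConst m p + pathConst m q + 1) := by
  have hm' : (2 : ℤ) ≤ m := by exact_mod_cast hm
  refine dualDPColor_eq Λ (by omega) (fun π => ?_) ?_
  · rw [hsrc, htgt, ncard_isProper_twoPaths hp hq, ← (finTwoArrowEquiv _).symm.sum_comp,
      Fintype.sum_prod_type]
    refine sum_le_mul fun i => ?_
    simpa [Unique.forall_iff] using sum_ite_ne_le (pathConst_nonneg hm' hp) (pathConst_nonneg hm' hq)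
      (π (Sum.inl ()) i) _ _
  · obtain ⟨σ, hσ⟩ := exists_derangement hm
    obtain ⟨π₁, hπ₁⟩ := exists_holonomy_eq (p := p) σ
    obtain ⟨π₂, hπ₂⟩ := exists_holonomy_eq (p := q) σ
    refine ⟨Sum.elim 1 (Sum.elim π₁ π₂), ?_⟩
    rw [hsrc, htgt, ncard_isProper_twoPaths hp hq, ← (finTwoArrowEquiv _).symm.sum_comp,
      Fintype.sum_prod_type]
    simp only [Sum.elim_inl, Sum.elim_inr, hπ₁, hπ₂]
    refine sum_eq_mul fun i => ?_
    simpa using sum_ite_ne_eq (pathConst m p) (pathConst m q) (hσ i)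

/-- A cycle formed by two paths with an odd number of inner vertices: the maximum is attained when
both paths have the same holonomy. -/
theorem dualDPColor_cycle (hp : Odd p) (hq : Odd q) (hm : 2 ≤ m)
    (Λ : Listing G (Fin 2 ⊕ (Fin p ⊕ Fin q)) (Empty ⊕ (Fin (p + 1) ⊕ Fin (q + 1))))
    (hsrc : Λ.src = twoPathsSrc 0 1 Empty.elim) (htgt : Λ.tgt = twoPathsTgt 0 1 Empty.elim) :
    (dualDPColor G m : ℤ) = m * (m * (pathConst m p * pathConst m q) +
      pathConst m p + pathConst m q + 1) := by
  refine dualDPColor_eq Λ (by omega) (fun π => ?_) ?_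
  · rw [hsrc, htgt, ncard_isProper_twoPaths hp hq, ← (finTwoArrowEquiv _).symm.sum_comp,
      Fintype.sum_prod_type]
    refine sum_le_mul fun i => ?_
    simpa using sum_mul_indicator_le (pathConst m p) (pathConst m q) _ _
  · obtain ⟨π₁, hπ₁⟩ := exists_holonomy_eq (p := p) (1 : Equiv.Perm (Fin m))
    obtain ⟨π₂, hπ₂⟩ := exists_holonomy_eq (p := q) (1 : Equiv.Perm (Fin m))
    refine ⟨Sum.elim 1 (Sum.elim π₁ π₂), ?_⟩
    rw [hsrc, htgt, ncard_isProper_twoPaths hp hq, ← (finTwoArrowEquiv _).symm.sum_comp,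
      Fintype.sum_prod_type]
    simp only [Sum.elim_inl, Sum.elim_inr, hπ₁, hπ₂]
    refine sum_eq_mul fun i => ?_
    simpa using sum_mul_indicator (pathConst m p) (pathConst m q) i i

/-- Two cycles of even length with a common vertex: the minimum is attained when the holonomies of
both cycles move every colour. -/
theorem dpColor_twoCycles (hp : Odd p) (hq : Odd q) (hm : 2 ≤ m)
    (Λ : Listing G (Unit ⊕ (Fin p ⊕ Fin q)) (Empty ⊕ (Fin (p + 1) ⊕ Fin (q + 1))))
    (hsrc : Λ.src = twoPathsSrc () () Empty.elim) (htgt : Λ.tgt = twoPathsTgt () () Empty.elim) :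
    (dpColor G m : ℤ) = m * (pathConst m p * pathConst m q) := by
  have hm' : (2 : ℤ) ≤ m := by exact_mod_cast hm
  refine dpColor_eq Λ (by omega) (fun π => ?_) ?_
  · rw [hsrc, htgt, ncard_isProper_twoPaths hp hq, ← (Equiv.funUnique Unit _).symm.sum_comp]
    refine mul_le_sum fun i => ?_
    simpa using le_mul_indicator (pathConst_nonneg hm' hp) (pathConst_nonneg hm' hq) _ _
  · obtain ⟨σ, hσ⟩ := exists_derangement hm
    obtain ⟨π₁, hπ₁⟩ := exists_holonomy_eq (p := p) σ
    obtain ⟨π₂, hπ₂⟩ := exists_holonomy_eq (p := q) σ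
    refine ⟨Sum.elim 1 (Sum.elim π₁ π₂), ?_⟩
    rw [hsrc, htgt, ncard_isProper_twoPaths hp hq, ← (Equiv.funUnique Unit _).symm.sum_comp]
    simp only [Sum.elim_inl, Sum.elim_inr, hπ₁, hπ₂]
    refine sum_eq_mul fun i => ?_
    simp [(hσ i).symm]

end Extremal

/-! ### Two odd cycles with a common edge -/

section Cycles

variable {α β : Type*} {G : Graph α β}

/-- `w` lists the vertices and `g` the edges of a path from `u` to `v` in `G`, which contains all
vertices of `G` and all its edges other than `e`. -/
structure IsPathAvoiding (G : Graph α β) (e : β) (u v : α) {n : ℕ} (w : Fin (n + 1) → α)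
    (g : Fin n → β) : Prop where
  vert_injective : Function.Injective w
  edge_injective : Function.Injective g
  first : w 0 = u
  last : w (Fin.last n) = v
  vertexSet_eq : V(G) = Set.range w
  edgeSet_eq : E(G) \ {e} = Set.range g
  isLink : ∀ i, G.IsLink (g i) (w i.castSucc) (w i.succ)

theorem IsPathAvoiding.reverse {e : β} {u v : α} {n : ℕ} {w : Fin (n + 1) → α} {g : Fin n → β}
    (h : IsPathAvoiding G e u v w g) : IsPathAvoiding G e v u (w ∘ Fin.rev) (g ∘ Fin.rev) where
  vert_injective := h.vert_injective.comp Fin.rev_injective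
  edge_injective := h.edge_injective.comp Fin.rev_injective
  first := by simpa using h.last
  last := by simpa using h.first
  vertexSet_eq := by rw [h.vertexSet_eq, Fin.rev_surjective.range_comp]
  edgeSet_eq := by rw [h.edgeSet_eq, Fin.rev_surjective.range_comp]
  isLink i := by
    simpa [Fin.rev_castSucc, Fin.rev_succ] using (h.isLink i.rev).symm

theorem natCast_zmod_inj {n a b : ℕ} (ha : a < n) (hb : b < n) (h : (a : ZMod n) = b) : a = b := by
  rw [ZMod.natCast_eq_natCast_iff', Nat.mod_eq_of_lt ha, Nat.mod_eq_of_lt hb] at h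
  exact h

/-- Deleting an edge from a cycle leaves a path between its endpoints. -/
theorem IsCycle.exists_isPathAvoiding {n : ℕ} (hG : IsCycle G (n + 1)) {e : β} {u v : α}
    (he : G.IsLink e u v) :
    ∃ (w : Fin (n + 1) → α) (g : Fin n → β), IsPathAvoiding G e u v w g := by
  obtain ⟨x, f, hx, hf, hV, hE, hlink⟩ := hG
  have hmem := he.edge_mem
  rw [hE] at hmem
  obtain ⟨i, rfl⟩ := hmem
  have hlast : i + 1 + (n : ZMod (n + 1)) = i := by
    have h := ZMod.natCast_self (n + 1)
    push_cast at h
    rw [add_assoc, add_comm (1 : ZMod (n + 1)), h, add_zero]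
  have hval : ∀ z : ZMod (n + 1), i + 1 + ((z - (i + 1)).val : ZMod (n + 1)) = z := fun z => by
    rw [ZMod.natCast_zmod_val]
    ring
  -- the path that starts after the edge `f i` and goes once around the cycle
  have key : IsPathAvoiding G (f i) (x (i + 1)) (x i)
      (fun t : Fin (n + 1) => x (i + 1 + (t : ℕ))) (fun t : Fin n => f (i + 1 + (t : ℕ))) := by
    refine ⟨?_, ?_, ?_, ?_, ?_, ?_, ?_⟩
    · intro s t hst
      exact Fin.ext (natCast_zmod_inj s.2 t.2 (add_left_cancel (hx hst)))
    · intro s t hst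
      exact Fin.ext (natCast_zmod_inj (s.2.trans n.lt_succ_self) (t.2.trans n.lt_succ_self)
        (add_left_cancel (hf hst)))
    · simp
    · simp [hlast]
    · rw [hV]
      ext y
      constructor
      · rintro ⟨z, rfl⟩
        exact ⟨⟨(z - (i + 1)).val, ZMod.val_lt _⟩, congrArg x (hval z)⟩
      · rintro ⟨t, rfl⟩
        exact ⟨_, rfl⟩
    · rw [hE]
      ext y
      constructor
      · rintro ⟨⟨z, rfl⟩, hz⟩
        have hlt := ZMod.val_lt (z - (i + 1))
        have hne : (z - (i + 1)).val ≠ n := by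
          intro h
          have h' := hval z
          rw [h, hlast] at h'
          exact hz (by rw [h']; rfl)
        exact ⟨⟨(z - (i + 1)).val, by omega⟩, congrArg f (hval z)⟩
      · rintro ⟨t, rfl⟩
        refine ⟨⟨_, rfl⟩, fun h => ?_⟩
        have h' := hf h
        nth_rewrite 2 [← hlast] at h'
        exact t.2.ne (natCast_zmod_inj (t.2.trans n.lt_succ_self) n.lt_succ_self
          (add_left_cancel h'))
    · intro t
      have h := hlink (i + 1 + (t : ℕ))
      simpa [add_assoc] using h
  rcases (hlink i).eq_and_eq_or_eq_and_eq he with ⟨rfl, rfl⟩ | ⟨rfl, rfl⟩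
  · exact ⟨_, _, key.reverse⟩
  · exact ⟨_, _, key⟩

theorem pathSeq_inner {p : ℕ} (w : Fin (p + 2) → α) :
    pathSeq (w 0) (w (Fin.last _)) (fun i : Fin p => w i.castSucc.succ) = w := by
  funext i
  induction i using Fin.cases with
  | zero => rfl
  | succ i =>
    induction i using Fin.lastCases with
    | last => simp [pathSeq]
    | cast i => simp [pathSeq]

theorem range_pathSeq {p : ℕ} (a b : α) (w : Fin p → α) :
    Set.range (pathSeq a b w) = {a, b} ∪ Set.range w := by
  ext y
  simp [pathSeq, or_assoc, eq_comm]

/-- The path of `IsCycle.exists_isPathAvoiding`, given by its inner vertices. -/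
theorem IsCycle.exists_pathSeq {p : ℕ} (hG : IsCycle G (p + 2)) {e : β} {u v : α}
    (he : G.IsLink e u v) :
    ∃ (w : Fin p → α) (g : Fin (p + 1) → β), IsPathAvoiding G e u v (pathSeq u v w) g := by
  obtain ⟨w, g, h⟩ := hG.exists_isPathAvoiding he
  obtain rfl := h.first
  obtain rfl := h.last
  exact ⟨_, g, by rwa [pathSeq_inner]⟩

theorem pathSeq_castSucc_ne_succ {p : ℕ} (hp : p ≠ 0) {a b : α} {w : Fin p → α}
    (hw : Function.Injective w) (ha : ∀ i, w i ≠ a) (hb : ∀ i, w i ≠ b) (i : Fin (p + 1)) :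
    pathSeq a b w i.castSucc ≠ pathSeq a b w i.succ := by
  obtain ⟨p, rfl⟩ := Nat.exists_eq_succ_of_ne_zero hp
  induction i using Fin.cases with
  | zero =>
    have h : pathSeq a b w (Fin.succ 0) = w 0 := by
      have h0 : (0 : Fin (p + 2)) = Fin.castSucc 0 := rfl
      rw [h0]
      simp only [pathSeq, Fin.cons_succ, Fin.snoc_castSucc]
    rw [h]
    exact (ha 0).symm
  | succ i =>
    rw [← Fin.succ_castSucc]
    simp only [pathSeq, Fin.cons_succ]
    rw [Fin.snoc_castSucc]
    induction i using Fin.lastCases with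
    | last => simpa using hb _
    | cast i =>
      rw [← Fin.castSucc_succ, Fin.snoc_castSucc]
      exact fun h => absurd (hw h) (Fin.castSucc_lt_succ).ne

/-- The listing of a graph that consists of two paths with common ends and some further edges. As
`a = b` is allowed, each path has to have an inner vertex, or else its only edge might be a loop. -/
def twoPathsListing {T X : Type} {p q : ℕ} (hp : p ≠ 0) (hq : q ≠ 0) (a b : T) (s t : X → T)
    (hst : ∀ x, s x ≠ t x) (z : T → α) (y : X → β) (w₁ : Fin p → α) (w₂ : Fin q → α)
    (g₁ : Fin (p + 1) → β) (g₂ : Fin (q + 1) → β)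
    (hvert : Function.Injective (Sum.elim z (Sum.elim w₁ w₂)))
    (hedge : Function.Injective (Sum.elim y (Sum.elim g₁ g₂)))
    (hV : V(G) = Set.range z ∪ (Set.range w₁ ∪ Set.range w₂))
    (hE : E(G) = Set.range y ∪ (Set.range g₁ ∪ Set.range g₂))
    (hy : ∀ x, G.IsLink (y x) (z (s x)) (z (t x)))
    (h₁ : ∀ i, G.IsLink (g₁ i) (pathSeq (z a) (z b) w₁ i.castSucc) (pathSeq (z a) (z b) w₁ i.succ))
    (h₂ : ∀ i, G.IsLink (g₂ i) (pathSeq (z a) (z b) w₂ i.castSucc)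
      (pathSeq (z a) (z b) w₂ i.succ)) :
    Listing G (T ⊕ (Fin p ⊕ Fin q)) (X ⊕ (Fin (p + 1) ⊕ Fin (q + 1))) where
  vert := Sum.elim z (Sum.elim w₁ w₂)
  edge := Sum.elim y (Sum.elim g₁ g₂)
  src := twoPathsSrc a b s
  tgt := twoPathsTgt a b t
  vert_injective := hvert
  edge_injective := hedge
  vertexSet_eq := by rw [hV, Set.Sum.elim_range, Set.Sum.elim_range]
  edgeSet_eq := by rw [hE, Set.Sum.elim_range, Set.Sum.elim_range]
  isLink := by
    rintro (x | i | i)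
    · exact hy x
    · simp only [twoPathsSrc, twoPathsTgt, Sum.elim_inr, Sum.elim_inl,
        comp_pathSeq (Sum.elim z (Sum.elim w₁ w₂))]
      exact h₁ i
    · simp only [twoPathsSrc, twoPathsTgt, Sum.elim_inr, Sum.elim_inl,
        comp_pathSeq (Sum.elim z (Sum.elim w₁ w₂))]
      exact h₂ i
  src_ne_tgt := by
    rintro (x | i | i)
    · exact fun h => hst x (Sum.inl_injective h)
    · exact pathSeq_castSucc_ne_succ hp (Sum.inr_injective.comp Sum.inl_injective)
        (fun _ => Sum.inr_ne_inl) (fun _ => Sum.inr_ne_inl) i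
    · exact pathSeq_castSucc_ne_succ hq (Sum.inr_injective.comp Sum.inr_injective)
        (fun _ => Sum.inr_ne_inl) (fun _ => Sum.inr_ne_inl) i

theorem Listing.deleteEdges_loops {ι κ : Type*} (Λ : Listing G ι κ) :
    G.deleteEdges {f | ∃ x, G.IsLoopAt f x} = G := by
  have h : {f | ∃ x, G.IsLoopAt f x} = ∅ := by
    refine Set.eq_empty_of_forall_notMem ?_
    rintro f ⟨x, hx⟩
    have hf := hx.edge_mem
    rw [Λ.edgeSet_eq] at hf
    obtain ⟨j, rfl⟩ := hf
    exact Λ.src_ne_tgt j (Λ.vert_injective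
      ((hx.eq_of_inc (Λ.isLink j).inc_left).symm.trans (hx.eq_of_inc (Λ.isLink j).inc_right)))
  rw [h, Graph.deleteEdges_empty]

theorem injective_pathSeq {p : ℕ} {a b : α} {w : Fin p → α}
    (h : Function.Injective (pathSeq a b w)) :
    a ≠ b ∧ Function.Injective w ∧ (∀ i, w i ≠ a) ∧ ∀ i, w i ≠ b := by
  rw [pathSeq, Fin.cons_injective_iff, Fin.snoc_injective_iff] at h
  obtain ⟨ha, hw, hb⟩ := h
  refine ⟨?_, hw, fun i hi => ha ⟨i.castSucc, by simpa using hi⟩, fun i hi => hb ⟨i, hi⟩⟩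
  rintro rfl
  exact ha ⟨Fin.last p, by simp⟩

/-- `G` consists of the edge `e` from `u` to `v` and of two internally disjoint paths from `u` to
`v`, with inner vertices `w₁`, `w₂` and edges `g₁`, `g₂`. -/
structure IsTheta (G : Graph α β) (e : β) (u v : α) {p q : ℕ} (w₁ : Fin p → α) (w₂ : Fin q → α)
    (g₁ : Fin (p + 1) → β) (g₂ : Fin (q + 1) → β) : Prop where
  ne : u ≠ v
  inner_injective : Function.Injective (Sum.elim w₁ w₂)
  inner_ne_left : ∀ i, Sum.elim w₁ w₂ i ≠ u
  inner_ne_right : ∀ i, Sum.elim w₁ w₂ i ≠ v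
  edge_injective : Function.Injective (Sum.elim g₁ g₂)
  edge_ne : ∀ i, Sum.elim g₁ g₂ i ≠ e
  vertexSet_eq : V(G) = {u, v} ∪ (Set.range w₁ ∪ Set.range w₂)
  edgeSet_eq : E(G) = {e} ∪ (Set.range g₁ ∪ Set.range g₂)
  isLink : G.IsLink e u v
  isLink₁ : ∀ i, G.IsLink (g₁ i) (pathSeq u v w₁ i.castSucc) (pathSeq u v w₁ i.succ)
  isLink₂ : ∀ i, G.IsLink (g₂ i) (pathSeq u v w₂ i.castSucc) (pathSeq u v w₂ i.succ)

/-- Two cycles with exactly two common vertices and exactly one common edge form a theta graph. -/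
theorem exists_isTheta {p q : ℕ} {G₁ G₂ : Graph α β} (hG₁ : IsCycle G₁ (p + 2))
    (hG₂ : IsCycle G₂ (q + 2)) (h₁ : G₁ ≤ G) (h₂ : G₂ ≤ G) (hV : V(G) = V(G₁) ∪ V(G₂))
    (hE : E(G) = E(G₁) ∪ E(G₂)) {e : β} {u v : α} (he : G.IsLink e u v)
    (hVcap : (V(G₁) ∩ V(G₂)).ncard = 2) (hEcap : E(G₁) ∩ E(G₂) = {e}) :
    ∃ (w₁ : Fin p → α) (w₂ : Fin q → α) (g₁ : Fin (p + 1) → β) (g₂ : Fin (q + 1) → β),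
      IsTheta G e u v w₁ w₂ g₁ g₂ := by
  have hmem : e ∈ E(G₁) ∩ E(G₂) := hEcap ▸ rfl
  have he₁ : G₁.IsLink e u v := (Graph.IsSubgraph.isLink_iff h₁ hmem.1).2 he
  have he₂ : G₂.IsLink e u v := (Graph.IsSubgraph.isLink_iff h₂ hmem.2).2 he
  obtain ⟨w₁, g₁, hp₁⟩ := hG₁.exists_pathSeq he₁
  obtain ⟨w₂, g₂, hp₂⟩ := hG₂.exists_pathSeq he₂
  obtain ⟨huv, hw₁, hu₁, hv₁⟩ := injective_pathSeq hp₁.vert_injective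
  obtain ⟨-, hw₂, hu₂, hv₂⟩ := injective_pathSeq hp₂.vert_injective
  have hV₁ := hp₁.vertexSet_eq
  have hV₂ := hp₂.vertexSet_eq
  rw [range_pathSeq] at hV₁ hV₂
  have hcap : {u, v} = V(G₁) ∩ V(G₂) := by
    refine Set.eq_of_subset_of_ncard_le ?_ ?_ (Set.finite_of_ncard_ne_zero (by omega))
    · rintro x (rfl | rfl)
      · exact ⟨he₁.left_mem, he₂.left_mem⟩
      · exact ⟨he₁.right_mem, he₂.right_mem⟩
    · rw [hVcap, Set.ncard_pair huv]
  have hg₁ : ∀ i, g₁ i ∈ E(G₁) \ {e} := fun i => hp₁.edgeSet_eq ▸ ⟨i, rfl⟩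
  have hg₂ : ∀ i, g₂ i ∈ E(G₂) \ {e} := fun i => hp₂.edgeSet_eq ▸ ⟨i, rfl⟩
  refine ⟨w₁, w₂, g₁, g₂, huv, hw₁.sumElim hw₂ ?_, ?_, ?_, hp₁.edge_injective.sumElim
    hp₂.edge_injective ?_, ?_, ?_, ?_, he, fun i => (hp₁.isLink i).mono h₁,
    fun i => (hp₂.isLink i).mono h₂⟩
  · intro i j hij
    have hi : w₁ i ∈ V(G₁) ∩ V(G₂) :=
      ⟨hV₁ ▸ Or.inr ⟨i, rfl⟩, hV₂ ▸ Or.inr ⟨j, hij.symm⟩⟩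
    rw [← hcap] at hi
    exact hi.elim (hu₁ i) (hv₁ i)
  · rintro (i | i)
    exacts [hu₁ i, hu₂ i]
  · rintro (i | i)
    exacts [hv₁ i, hv₂ i]
  · intro i j hij
    have hi : g₁ i ∈ E(G₁) ∩ E(G₂) := ⟨(hg₁ i).1, hij ▸ (hg₂ j).1⟩
    rw [hEcap] at hi
    exact (hg₁ i).2 hi
  · rintro (i | i)
    exacts [(hg₁ i).2, (hg₂ i).2]
  · rw [hV, hV₁, hV₂]
    exact (Set.union_union_distrib_left _ _ _).symm
  · rw [hE, ← hp₁.edgeSet_eq, ← hp₂.edgeSet_eq, ← Set.union_sdiff_distrib, Set.union_sdiff_self]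
    exact (Set.union_eq_self_of_subset_left
      (Set.singleton_subset_iff.2 (Set.mem_union_left _ hmem.1))).symm

namespace IsTheta

variable {e : β} {u v : α} {p q : ℕ} {w₁ : Fin p → α} {w₂ : Fin q → α} {g₁ : Fin (p + 1) → β}
  {g₂ : Fin (q + 1) → β} (h : IsTheta G e u v w₁ w₂ g₁ g₂)

include h

theorem injective_ends : Function.Injective (Sum.elim ![u, v] (Sum.elim w₁ w₂)) := by
  refine Function.Injective.sumElim ?_ h.inner_injective ?_
  · intro i j hij
    fin_cases i <;> fin_cases j <;> simp_all [h.ne, h.ne.symm]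
  · intro i j
    fin_cases i
    · exact (h.inner_ne_left j).symm
    · exact (h.inner_ne_right j).symm

theorem exists_listing (hp : p ≠ 0) (hq : q ≠ 0) :
    ∃ Λ : Listing G (Fin 2 ⊕ (Fin p ⊕ Fin q)) (Unit ⊕ (Fin (p + 1) ⊕ Fin (q + 1))),
      Λ.src = twoPathsSrc 0 1 (fun _ => 0) ∧ Λ.tgt = twoPathsTgt 0 1 (fun _ => 1) := by
  refine ⟨twoPathsListing hp hq 0 1 (fun _ => 0) (fun _ => 1) (by simp) ![u, v] (fun _ => e)
    w₁ w₂ g₁ g₂ h.injective_ends ?_ ?_ ?_ (fun _ => h.isLink) h.isLink₁ h.isLink₂, rfl, rfl⟩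
  · exact (Function.injective_of_subsingleton _).sumElim h.edge_injective
      fun _ i => (h.edge_ne i).symm
  · rw [h.vertexSet_eq, Matrix.range_cons, Matrix.range_cons, Matrix.range_empty, Set.union_empty]
    rfl
  · rw [h.edgeSet_eq, Set.range_const]

theorem edgeSet_deleteEdges :
    E(G.deleteEdges {e}) = Set.range g₁ ∪ Set.range g₂ := by
  rw [Graph.edgeSet_deleteEdges, h.edgeSet_eq, Set.union_sdiff_left, ← Set.Sum.elim_range,
    Set.sdiff_singleton_eq_self]
  rintro ⟨i, hi⟩
  exact h.edge_ne i hi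

theorem isLink_deleteEdges {f : β} {x y : α} (hf : f ∈ Set.range g₁ ∪ Set.range g₂)
    (hxy : G.IsLink f x y) : (G.deleteEdges {e}).IsLink f x y := by
  rw [Graph.deleteEdges_isLink]
  refine ⟨hxy, ?_⟩
  rw [← h.edgeSet_deleteEdges, Graph.edgeSet_deleteEdges] at hf
  exact hf.2

theorem exists_listing_deleteEdges (hp : p ≠ 0) (hq : q ≠ 0) :
    ∃ Λ : Listing (G.deleteEdges {e}) (Fin 2 ⊕ (Fin p ⊕ Fin q))
      (Empty ⊕ (Fin (p + 1) ⊕ Fin (q + 1))),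
      Λ.src = twoPathsSrc 0 1 Empty.elim ∧ Λ.tgt = twoPathsTgt 0 1 Empty.elim := by
  refine ⟨twoPathsListing hp hq 0 1 Empty.elim Empty.elim (fun x => x.elim) ![u, v] Empty.elim
    w₁ w₂ g₁ g₂ h.injective_ends ?_ ?_ ?_ (fun x => x.elim)
    (fun i => h.isLink_deleteEdges (Or.inl ⟨i, rfl⟩) (h.isLink₁ i))
    (fun i => h.isLink_deleteEdges (Or.inr ⟨i, rfl⟩) (h.isLink₂ i)), rfl, rfl⟩
  · exact (Function.injective_of_subsingleton _).sumElim h.edge_injective fun x => x.elim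
  · rw [Graph.vertexSet_deleteEdges, h.vertexSet_eq, Matrix.range_cons, Matrix.range_cons,
      Matrix.range_empty, Set.union_empty]
    rfl
  · rw [h.edgeSet_deleteEdges, Set.range_eq_empty (Empty.elim : Empty → β), Set.empty_union]

open Classical in
/-- Identifying the ends of the two paths turns them into two cycles with a common vertex. Each has
at least two edges, so that no loops arise. -/
theorem exists_listing_contractEdge (hp : p ≠ 0) (hq : q ≠ 0) :
    ∃ Λ : Listing (contractEdge G e u v) (Unit ⊕ (Fin p ⊕ Fin q))
      (Empty ⊕ (Fin (p + 1) ⊕ Fin (q + 1))),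
      Λ.src = twoPathsSrc () () Empty.elim ∧ Λ.tgt = twoPathsTgt () () Empty.elim := by
  set φ : α → α := fun x => if x = v then u else x with hφ
  have hφu : φ u = u := by simp [hφ]
  have hφv : φ v = u := by simp [hφ]
  have hφ₁ : φ ∘ w₁ = w₁ := funext fun i => if_neg (h.inner_ne_right (Sum.inl i))
  have hφ₂ : φ ∘ w₂ = w₂ := funext fun i => if_neg (h.inner_ne_right (Sum.inr i))
  have hlink₁ : ∀ i, ((G.deleteEdges {e}).map φ).IsLink (g₁ i) (pathSeq u u w₁ i.castSucc)
      (pathSeq u u w₁ i.succ) := by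
    intro i
    have hi := (h.isLink_deleteEdges (Or.inl ⟨i, rfl⟩) (h.isLink₁ i)).map φ
    rwa [comp_pathSeq φ, comp_pathSeq φ, hφu, hφv, hφ₁] at hi
  have hlink₂ : ∀ i, ((G.deleteEdges {e}).map φ).IsLink (g₂ i) (pathSeq u u w₂ i.castSucc)
      (pathSeq u u w₂ i.succ) := by
    intro i
    have hi := (h.isLink_deleteEdges (Or.inr ⟨i, rfl⟩) (h.isLink₂ i)).map φ
    rwa [comp_pathSeq φ, comp_pathSeq φ, hφu, hφv, hφ₂] at hi
  have hΛ : ∃ Λ : Listing ((G.deleteEdges {e}).map φ) (Unit ⊕ (Fin p ⊕ Fin q))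
      (Empty ⊕ (Fin (p + 1) ⊕ Fin (q + 1))),
      Λ.src = twoPathsSrc () () Empty.elim ∧ Λ.tgt = twoPathsTgt () () Empty.elim := by
    refine ⟨twoPathsListing hp hq () () Empty.elim Empty.elim (fun x => x.elim) (fun _ => u)
      Empty.elim w₁ w₂ g₁ g₂ ?_ ?_ ?_ ?_ (fun x => x.elim) hlink₁ hlink₂, rfl, rfl⟩
    · exact (Function.injective_of_subsingleton _).sumElim h.inner_injective
        fun _ i => (h.inner_ne_left i).symm
    · exact (Function.injective_of_subsingleton _).sumElim h.edge_injective fun x => x.elim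
    · rw [Graph.vertexSet_map, Graph.vertexSet_deleteEdges, h.vertexSet_eq, Set.image_union,
        Set.image_union, Set.image_pair, ← Set.range_comp, ← Set.range_comp, hφ₁, hφ₂, hφu, hφv,
        Set.pair_eq_singleton, Set.range_const]
    · rw [Graph.edgeSet_map, h.edgeSet_deleteEdges, Set.range_eq_empty (Empty.elim : Empty → β),
        Set.empty_union]
  obtain ⟨Λ, hΛ⟩ := hΛ
  have hK : contractEdge G e u v = (G.deleteEdges {e}).map φ := Λ.deleteEdges_loops
  rw [hK]
  exact ⟨Λ, hΛ⟩

end IsTheta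

end Cycles

end DPColoring

theorem mainTheorem6 {α β : Type*} (k l : ℕ) (hk : 1 ≤ k) (hl : 1 ≤ l)
    (G₁ G₂ G : Graph α β)
    (hG₁ : DPColoring.IsCycle G₁ (2 * k + 1)) (hG₂ : DPColoring.IsCycle G₂ (2 * l + 1))
    (h₁ : G₁ ≤ G) (h₂ : G₂ ≤ G)
    (hV : V(G) = V(G₁) ∪ V(G₂)) (hE : E(G) = E(G₁) ∪ E(G₂))
    (e : β) (u v : α) (he : G.IsLink e u v)
    (hVcap : (V(G₁) ∩ V(G₂)).ncard = 2) (hEcap : E(G₁) ∩ E(G₂) = {e})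
    (m : ℕ) (hm : 2 ≤ m) :
    (DPColoring.dualDPColor G m : ℚ) =
        ((m : ℚ) - 1) ^ (2 * k + 2 * l) + ((m : ℚ) - 1) -
          (((m : ℚ) - 1) ^ (2 * k) - 1) * (((m : ℚ) - 1) ^ (2 * l) - 1) / (m : ℚ) ∧
      (DPColoring.dualDPColor G m : ℤ) =
        (DPColoring.dualDPColor (G.deleteEdges {e}) m : ℤ) -
          (DPColoring.dpColor (DPColoring.contractEdge G e u v) m : ℤ) := by
  open DPColoring in
  obtain ⟨k, rfl⟩ := Nat.exists_eq_add_of_le' hk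
  obtain ⟨l, rfl⟩ := Nat.exists_eq_add_of_le' hl
  -- the paths that remain of the cycles have `2 k - 1` and `2 l - 1` inner vertices
  obtain ⟨w₁, w₂, g₁, g₂, h⟩ :=
    exists_isTheta (p := 2 * k + 1) (q := 2 * l + 1) hG₁ hG₂ h₁ h₂ hV hE he hVcap hEcap
  have hp : Odd (2 * k + 1) := odd_two_mul_add_one k
  have hq : Odd (2 * l + 1) := odd_two_mul_add_one l
  obtain ⟨Λ, hs, ht⟩ := h.exists_listing hp.pos.ne' hq.pos.ne'
  obtain ⟨Λ', hs', ht'⟩ := h.exists_listing_deleteEdges hp.pos.ne' hq.pos.ne'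
  obtain ⟨Λ'', hs'', ht''⟩ := h.exists_listing_contractEdge hp.pos.ne' hq.pos.ne'
  have hG := dualDPColor_theta hp hq hm Λ hs ht
  have hG' := dualDPColor_cycle hp hq hm Λ' hs' ht'
  have hG'' := dpColor_twoCycles hp hq hm Λ'' hs'' ht''
  refine ⟨?_, by rw [hG, hG', hG'']; ring⟩
  have hc := mul_pathConst m (2 * k + 1)
  have hd := mul_pathConst m (2 * l + 1)
  rw [hp.add_one.neg_one_pow] at hc
  rw [hq.add_one.neg_one_pow] at hd
  have hm0 : (m : ℚ) ≠ 0 := by positivity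
  have hGQ : (dualDPColor G m : ℚ) = m * ((m - 1) * (pathConst m (2 * k + 1) *
      pathConst m (2 * l + 1)) + pathConst m (2 * k + 1) + pathConst m (2 * l + 1) + 1) := by
    exact_mod_cast hG
  have hcQ : (m : ℚ) * pathConst m (2 * k + 1) = (m - 1) ^ (2 * (k + 1)) - 1 := by
    exact_mod_cast hc
  have hdQ : (m : ℚ) * pathConst m (2 * l + 1) = (m - 1) ^ (2 * (l + 1)) - 1 := by
    exact_mod_cast hd
  rw [hGQ, pow_add, ← hcQ, ← hdQ, sub_eq_iff_eq_add.1 hcQ.symm, sub_eq_iff_eq_add.1 hdQ.symm]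
  field_simp
  ring
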